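/- Let $T,\gamma,\lambda>0$, $a\in\mathbb{R}$, and let $(\Omega,\mathcal{F},(\mathcal{F}_t)_{t\in[0,T]},Q)$ be a filtered probability space (the filtration need be neither complete nor right-continuous). Write $E$ for the expectation under $Q$ and $E_t[\cdot]=E[\cdot\,|\,\mathcal{F}_t]$. Let $\mathscr{L}^p(Q)$ be the set of progressively measurable processes $\phi=(\phi_t)_{0\le t\le T}$ with $E[\int_0^T|\phi_t|^p\,dt]<\infty$. Let $S$ be a progressively measurable Itô price process $$dS_t=\mu_t\,dt+\nu_t\,dW_t,\qquad \mu,\nu\in\mathscr{L}^4(Q),$$ where $W$ is a finite-dimensional Brownian motion under $Q$ relative to $(\mathcal{F}_t)$ (adaptedness up to $Q$-null sets suffices). A *portfolio* is a scalar process $\phi\in\mathscr{L}^4(Q)$ with $\phi_0=a$ that is (almost surely) absolutely continuous with rate $\dot\phi\in\mathscr{L}^4(Q)$. It is *optimal* if it maximizes $$J(\phi)=E\left[\int_0^T\left(\phi_t\,dS_t-\frac{\gamma}{2}\phi_t^2\,dt-\frac{\lambda}{2}\dot\phi_t^2\,dt\right)\right]$$ over all portfolios. Let $G(t)=\cosh\left(\sqrt{\gamma/\lambda}\,(T-t)\right)$,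 $t\in[0,T]$. Then the process $s\mapsto E_s\left[\int_s^T\frac{G(u)}{G(s)}\frac{\mu_u}{\lambda}\,du\right]$ has a progressively measurable version, and, with any such version, the $dt\times Q$-a.e. unique optimal portfolio is $$\phi_t=\frac{G(t)}{G(0)}\,a+\int_0^t\frac{G(t)}{G(s)}\,E_s\left[\int_s^T\frac{G(u)}{G(s)}\frac{\mu_u}{\lambda}\,du\right]ds .$$ Its trading rate is given by the right-hand side of the random ODE below, and the ODE characterizes optimality: a portfolio $\phi$ is optimal if and only if $$\dot\phi_t=\frac{G'(t)}{G(t)}\,\phi_t+E_t\left[\int_t^T\frac{G(s)}{G(t)}\frac{\mu_s}{\lambda}\,ds\right],\quad \phi_0=a,\qquad dt\times Q\text{-a.e.}$$ -/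

import Mathlib

open MeasureTheory ProbabilityTheory Set Filter Topology
open scoped ENNReal

noncomputable section

/-! Processes on the time interval `[0, T]` are functions `ℝ → Ω → E` and filtrations are indexed
by `ℝ`; only their restrictions to times in `[0, T]` are ever used (a filtration indexed by
`[0, T]` is extended by `ℱ 0` to the left and by `ℱ T` to the right). No completeness or
right-continuity of filtrations is assumed. -/

namespace LiquidityModel

variable {Ω : Type*} [mΩ : MeasurableSpace Ω]

/-- The process `φ` is progressively measurable on `[0, T]`: for each `t ∈ [0, T]`, the map
`(s, ω) ↦ φ s ω` on `[0, t] × Ω` is measurable for the product of the Borel `σ`-field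
and `ℱ t`. -/
def ProgressiveOn {E : Type*} [TopologicalSpace E] (ℱ : Filtration ℝ mΩ) (T : ℝ)
    (φ : ℝ → Ω → E) : Prop :=
  ∀ t ∈ Icc (0 : ℝ) T,
    StronglyMeasurable[(inferInstance : MeasurableSpace (Icc (0 : ℝ) t)).prod (ℱ t)]
      (fun p : Icc (0 : ℝ) t × Ω => φ p.1 p.2)

/-- The product measure `dt × P` on `[0, T] × Ω`. -/
def timeProd (P : Measure Ω) (T : ℝ) : Measure (ℝ × Ω) :=
  (volume.restrict (Icc (0 : ℝ) T)).prod P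

/-- The space `𝓛ᵖ(P)` of progressively measurable processes `φ` on `[0, T]` with
`E[∫₀ᵀ |φ_t|ᵖ dt] < ∞`. -/
def IsProgLp {E : Type*} [NormedAddCommGroup E] (p : ℝ≥0∞) (ℱ : Filtration ℝ mΩ)
    (P : Measure Ω) (T : ℝ) (φ : ℝ → Ω → E) : Prop :=
  ProgressiveOn ℱ T φ ∧ MemLp (fun x : ℝ × Ω => φ x.1 x.2) p (timeProd P T)

/-! ### Brownian motion and the Itô integral -/

/-- `W` is an `m`-dimensional Brownian motion on `[0, T]` under `P`, relative to the filtration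
`ℱ`. Adaptedness is required up to `P`-null sets only, so that `ℱ` need not be completed. -/
structure IsBrownianMotionOn {m : ℕ} (ℱ : Filtration ℝ mΩ) (P : Measure Ω) (T : ℝ)
    (W : ℝ → Ω → EuclideanSpace ℝ (Fin m)) : Prop where
  adapted : ∀ t ∈ Icc (0 : ℝ) T, AEStronglyMeasurable[ℱ t] (W t) P
  zero : ∀ᵐ ω ∂P, W 0 ω = 0
  continuous : ∀ᵐ ω ∂P, ContinuousOn (fun t => W t ω) (Icc 0 T)
  law : ∀ s t : ℝ, 0 ≤ s → s ≤ t → t ≤ T →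
    HasLaw (fun ω => W t ω - W s ω)
      (multivariateGaussian 0 ((t - s) • (1 : Matrix (Fin m) (Fin m) ℝ))) P
  indep : ∀ s t : ℝ, 0 ≤ s → s ≤ t → t ≤ T →
    Indep (ℱ s) (MeasurableSpace.comap (fun ω => W t ω - W s ω) inferInstance) P

/-- A simple process `∑_{k < n} H_k 1_{(t_k, t_{k+1}]}` with `0 ≤ t_0 ≤ t_1 ≤ ⋯ ≤ t_n ≤ T`
and bounded, `ℱ_{t_k}`-measurable, `ℝᵐ`-valued coefficients `H_k`. -/
structure SimpleProcess (ℱ : Filtration ℝ mΩ) (T : ℝ) (m : ℕ) where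
  n : ℕ
  time : ℕ → ℝ
  time_mono : Monotone time
  time_mem : ∀ k ≤ n, time k ∈ Icc (0 : ℝ) T
  coeff : ℕ → Ω → EuclideanSpace ℝ (Fin m)
  coeff_meas : ∀ k < n, StronglyMeasurable[ℱ (time k)] (coeff k)
  coeff_bdd : ∃ C : ℝ, ∀ k < n, ∀ ω, ‖coeff k ω‖ ≤ C

namespace SimpleProcess

variable {ℱ : Filtration ℝ mΩ} {T : ℝ} {m : ℕ}

/-- The value of a simple process at time `t`. -/
def val (H : SimpleProcess ℱ T m) (t : ℝ) (ω : Ω) : EuclideanSpace ℝ (Fin m) :=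
  ∑ k ∈ Finset.range H.n,
    (Ioc (H.time k) (H.time (k + 1))).indicator (fun _ => H.coeff k ω) t

/-- The elementary stochastic integral `∫₀ᵗ H dW` of a simple process. -/
def integral (H : SimpleProcess ℱ T m) (W : ℝ → Ω → EuclideanSpace ℝ (Fin m))
    (t : ℝ) (ω : Ω) : ℝ :=
  ∑ k ∈ Finset.range H.n,
    inner ℝ (H.coeff k ω) (W (min (H.time (k + 1)) t) ω - W (min (H.time k) t) ω)

end SimpleProcess

/-- `I` is (a version, with almost surely continuous paths, of) the Itô integral process
`I_t = ∫₀ᵗ H_s · dW_s`, `t ∈ [0, T]`: it is the `L²(P)`-limit, at each time, of the elementary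
integrals of simple processes converging to `H` in `L²(dt × P)`. -/
def IsItoIntegral {m : ℕ} (ℱ : Filtration ℝ mΩ) (P : Measure Ω) (T : ℝ)
    (W : ℝ → Ω → EuclideanSpace ℝ (Fin m)) (H : ℝ → Ω → EuclideanSpace ℝ (Fin m))
    (I : ℝ → Ω → ℝ) : Prop :=
  IsProgLp 2 ℱ P T H ∧
  (∀ t ∈ Icc (0 : ℝ) T, AEStronglyMeasurable[ℱ t] (I t) P) ∧
  (∀ᵐ ω ∂P, ContinuousOn (fun t => I t ω) (Icc 0 T)) ∧
  ∃ Hn : ℕ → SimpleProcess ℱ T m,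
    Tendsto (fun n => eLpNorm (fun x : ℝ × Ω => (Hn n).val x.1 x.2 - H x.1 x.2) 2 (timeProd P T))
      atTop (𝓝 0) ∧
    ∀ t ∈ Icc (0 : ℝ) T,
      Tendsto (fun n => eLpNorm (fun ω => (Hn n).integral W t ω - I t ω) 2 P) atTop (𝓝 0)

open Classical in
/-- The Itô integral process `∫₀ᵗ H_s · dW_s`, `t ∈ [0, T]`. For a Brownian motion `W` and
`H ∈ 𝓛²(P)` it exists and is unique up to indistinguishability; the value `0` is a convention for
integrands without an Itô integral. -/
def itoIntegral {m : ℕ} (ℱ : Filtration ℝ mΩ) (P : Measure Ω) (T : ℝ)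
    (W : ℝ → Ω → EuclideanSpace ℝ (Fin m)) (H : ℝ → Ω → EuclideanSpace ℝ (Fin m)) :
    ℝ → Ω → ℝ :=
  if h : ∃ I, IsItoIntegral ℱ P T W H I then h.choose else 0

/-- An Itô process `S` on `[0, T]` under `P`,
`dS_t = μ_t dt + ν_t · dW_t` with `μ, ν ∈ 𝓛⁴(P)`, for an `m`-dimensional Brownian motion `W`. -/
structure ItoPriceProcess (ℱ : Filtration ℝ mΩ) (P : Measure Ω) (T : ℝ) (m : ℕ) where
  S : ℝ → Ω → ℝ
  μ : ℝ → Ω → ℝ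
  ν : ℝ → Ω → EuclideanSpace ℝ (Fin m)
  W : ℝ → Ω → EuclideanSpace ℝ (Fin m)
  brownian : IsBrownianMotionOn ℱ P T W
  prog : ProgressiveOn ℱ T S
  drift_mem : IsProgLp 4 ℱ P T μ
  vol_mem : IsProgLp 4 ℱ P T ν
  dynamics : ∃ I, IsItoIntegral ℱ P T W ν I ∧
    ∀ᵐ ω ∂P, ∀ t ∈ Icc (0 : ℝ) T, S t ω = S 0 ω + (∫ s in (0 : ℝ)..t, μ s ω) + I t ω

variable {ℱ : Filtration ℝ mΩ} {P : Measure Ω} {T : ℝ} {m : ℕ}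

/-- The gains from trading
`∫₀ᵀ φ_t dS_t = ∫₀ᵀ φ_t μ_t dt + ∫₀ᵀ φ_t ν_t · dW_t`. -/
def ItoPriceProcess.gains (S : ItoPriceProcess ℱ P T m) (φ : ℝ → Ω → ℝ) (ω : Ω) : ℝ :=
  (∫ t in (0 : ℝ)..T, φ t ω * S.μ t ω) +
    itoIntegral ℱ P T S.W (fun t ω => φ t ω • S.ν t ω) T ω

/-! ### Portfolios and the agent's problem -/

/-- `φ` is an admissible portfolio with initial position `a` and trading rate `φ'`:
`φ` and `φ'` belong to `𝓛⁴(P)`, and almost every path of `φ` starts at `a` and is absolutely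
continuous with derivative `φ'`. -/
def IsPortfolio (ℱ : Filtration ℝ mΩ) (P : Measure Ω) (T a : ℝ) (φ φ' : ℝ → Ω → ℝ) : Prop :=
  IsProgLp 4 ℱ P T φ ∧ IsProgLp 4 ℱ P T φ' ∧
    ∀ᵐ ω ∂P, ∀ t ∈ Icc (0 : ℝ) T, φ t ω = a + ∫ s in (0 : ℝ)..t, φ' s ω

/-- The objective
`J(φ) = E[∫₀ᵀ (φ_t dS_t - (γ/2) φ_t² dt - (lam/2) φ'_t² dt)]` of the agent. -/
def objective (S : ItoPriceProcess ℱ P T m) (γ lam : ℝ) (φ φ' : ℝ → Ω → ℝ) : ℝ :=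
  ∫ ω, (S.gains φ ω - (∫ t in (0 : ℝ)..T, γ / 2 * φ t ω ^ 2)
    - ∫ t in (0 : ℝ)..T, lam / 2 * φ' t ω ^ 2) ∂P

/-- `φ` (with rate `φ'`) is an optimal portfolio: a maximizer of the objective over the
admissible portfolios with initial position `a`. -/
def IsOptimal (S : ItoPriceProcess ℱ P T m) (γ lam a : ℝ) (φ φ' : ℝ → Ω → ℝ) : Prop :=
  IsPortfolio ℱ P T a φ φ' ∧
    ∀ ψ ψ' : ℝ → Ω → ℝ, IsPortfolio ℱ P T a ψ ψ' →
      objective S γ lam ψ ψ' ≤ objective S γ lam φ φ'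

/-- `G(t) = cosh(√(γ/lam) (T - t))`. -/
def G (T γ lam t : ℝ) : ℝ := Real.cosh (√(γ / lam) * (T - t))

/-- `ξ` is a progressively measurable version of the process
`s ↦ E[∫ₛᵀ (G(u)/G(s)) (μ_u/lam) du | ℱ_s]`, `s ∈ [0, T]`. -/
def IsSignal (S : ItoPriceProcess ℱ P T m) (γ lam : ℝ) (ξ : ℝ → Ω → ℝ) : Prop :=
  ProgressiveOn ℱ T ξ ∧
    ∀ s ∈ Icc (0 : ℝ) T,
      ξ s =ᵐ[P] P[fun ω => ∫ u in s..T, G T γ lam u / G T γ lam s * (S.μ u ω / lam) | ℱ s]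

/-- `φ_t = (G(t)/G(0)) a + ∫₀ᵗ (G(t)/G(s)) ξ_s ds`. -/
def position (T γ lam a : ℝ) (ξ : ℝ → Ω → ℝ) (t : ℝ) (ω : Ω) : ℝ :=
  G T γ lam t / G T γ lam 0 * a + ∫ s in (0 : ℝ)..t, G T γ lam t / G T γ lam s * ξ s ω

/-- The right-hand side `(G'(t)/G(t)) φ_t + ξ_t` of the random ODE for the trading rate. -/
def rate (T γ lam : ℝ) (ξ φ : ℝ → Ω → ℝ) (t : ℝ) (ω : Ω) : ℝ :=
  deriv (G T γ lam) t / G T γ lam t * φ t ω + ξ t ω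

end LiquidityModel

end

/-!
The proof completes the square in the objective. Write `g = G'/G` and let `k = φ' - g φ` be the
*control* of a portfolio `φ`. The function `g` solves the Riccati equation `g' = γ/lam - g²` and
vanishes at `T`, so integrating the rate of `g φ²` turns the quadratic costs of a path into
`(lam/2) ∫ k²` minus the constant `(lam/2) g(0) a²` (`HasRateOn.integral_cost`). Since `k/G` is the
rate of `φ/G`, integration by parts writes the drift gains `∫ φ μ` as `lam ∫ k Ξ` plus a term that
depends on `φ` only through `a`, where `Ξ_t = ∫ₜᵀ (G(u)/G(t)) (μ_u/lam) du` is the discounted future drift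
(`HasRateOn.integral_mul_drift`). In expectation the stochastic integral vanishes
(`integrable_and_integral_itoIntegral`), and `Ξ` may be replaced by the signal `ξ_t = E_t[Ξ_t]`, as
`k` is adapted (`IsSignal.integral_mul_futureDrift`). Hence
`J(φ) = const - (lam/2) E ∫ (φ' - g φ - ξ)²`, which is `IsPortfolio.objective_eq`. So a portfolio
with `φ' = g φ + ξ` is optimal, and as soon as there is one, every optimal portfolio solves this
ODE. By variation of constants, its only solution is the explicit formula, which is a portfolio
since `ξ ∈ 𝓛⁴` by conditional Jensen.

A progressively measurable version of the signal exists because `G(t) ξ_t` is the martingale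
`E_t[N]`, `N = ∫₀ᵀ G(u) μ_u/lam du`, minus a progressively measurable integral. Without assumptions
on the filtration, this martingale has a progressively measurable version by
`exists_progressiveOn_condExp`: by Lévy's upward theorem it is, at each time, the almost sure limit
along dyadic times from the left, except at the countably many discontinuities of its second moment.
-/

namespace LiquidityModel

/-! ### Paths with integrable rates -/

/-- On `[0, T]`, the function `f` is absolutely continuous with rate `f'`, in the sense that `f` is
a primitive of the integrable function `f'`. -/
structure HasRateOn (T : ℝ) (f f' : ℝ → ℝ) : Prop where
  integrable : IntervalIntegrable f' volume 0 T
  eq : ∀ t ∈ Icc (0 : ℝ) T, f t = f 0 + ∫ s in (0 : ℝ)..t, f' s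

namespace HasRateOn

variable {T : ℝ} {f f' g g' : ℝ → ℝ}

lemma congr_rate (hf : HasRateOn T f f') (h : ∀ s, f' s = g' s) : HasRateOn T f g' := by
  rwa [← funext h]

lemma continuousOn (hT : 0 ≤ T) (hf : HasRateOn T f f') : ContinuousOn f (Icc 0 T) := by
  have h := intervalIntegral.continuousOn_primitive_interval' hf.integrable
    (a := 0) (by simp)
  rw [uIcc_of_le hT] at h
  exact (continuousOn_const.add h).congr hf.eq

lemma of_hasDerivAt (h : ∀ t, HasDerivAt f (f' t) t) (hc : Continuous f') : HasRateOn T f f' where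
  integrable := hc.intervalIntegrable _ _
  eq t _ := by
    rw [intervalIntegral.integral_eq_sub_of_hasDerivAt (fun s _ => h s)
      (hc.intervalIntegrable _ _)]
    ring

/-- The product rule for absolutely continuous functions. -/
lemma mul (hT : 0 ≤ T) (hf : HasRateOn T f f') (hg : HasRateOn T g g') :
    HasRateOn T (fun t => f t * g t) (fun t => f' t * g t + f t * g' t) where
  integrable := by
    refine (hf.integrable.mul_continuousOn ?_).add (hg.integrable.continuousOn_mul ?_) <;>
      rw [uIcc_of_le hT]
    exacts [hg.continuousOn hT, hf.continuousOn hT]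
  eq t ht := by
    have hsub : uIcc 0 t ⊆ uIcc 0 T := by
      rw [uIcc_of_le ht.1, uIcc_of_le hT]; exact Icc_subset_Icc_right ht.2
    have hft := hf.integrable.mono_set hsub
    have hgt := hg.integrable.mono_set hsub
    have key := fun (u : ℝ → ℝ) (c : ℝ) (hu : IntervalIntegrable u volume 0 t) =>
      (contDiffOn_const (c := c)).absolutelyContinuousOnInterval (a := 0) (b := t)
        |>.add (hu.absolutelyContinuousOnInterval_intervalIntegral (c := 0) (by simp))
    have h := (key f' (f 0) hft).integral_deriv_mul_eq_sub (key g' (g 0) hgt)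
    have hcongr : ∫ s in (0 : ℝ)..t, (f' s * g s + f s * g' s) = f t * g t - f 0 * g 0 := by
      rw [hf.eq t ht, hg.eq t ht]
      refine (intervalIntegral.integral_congr_ae ?_).trans (h.trans ?_)
      · filter_upwards [hft.ae_hasDerivAt_integral, hgt.ae_hasDerivAt_integral] with s h1 h2 hs
        have hs' : s ∈ uIcc 0 t := uIoc_subset_uIcc hs
        have hsT : s ∈ Icc 0 T := by
          rw [← uIcc_of_le hT]; exact hsub hs'
        have d1 := ((h1 hs' 0 (by simp)).const_add (f 0)).deriv
        have d2 := ((h2 hs' 0 (by simp)).const_add (g 0)).deriv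
        rw [hf.eq s hsT, hg.eq s hsT]
        exact congrArg₂ (· + ·) (congrArg₂ (· * ·) d1.symm rfl) (congrArg₂ (· * ·) rfl d2.symm)
      · simp
    rw [hcongr]; ring

end HasRateOn

/-! ### The discount function and its Riccati equation -/

section Discount

variable {T γ lam : ℝ}

/-- The logarithmic derivative of `G`. -/
noncomputable def logDerivG (T γ lam t : ℝ) : ℝ :=
  deriv (G T γ lam) t / G T γ lam t

lemma G_pos (t : ℝ) : 0 < G T γ lam t := Real.cosh_pos _

lemma G_ne_zero (t : ℝ) : G T γ lam t ≠ 0 := (G_pos t).ne'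

lemma hasDerivAt_G' (t : ℝ) :
    HasDerivAt (G T γ lam) (-√(γ / lam) * Real.sinh (√(γ / lam) * (T - t))) t := by
  have h : HasDerivAt (fun t => √(γ / lam) * (T - t)) (√(γ / lam) * (-1)) t :=
    ((hasDerivAt_id t).const_sub T).const_mul _
  have h' := h.cosh
  convert! h' using 1
  ring

lemma deriv_G (t : ℝ) :
    deriv (G T γ lam) t = -√(γ / lam) * Real.sinh (√(γ / lam) * (T - t)) :=
  (hasDerivAt_G' t).deriv

lemma hasDerivAt_G (t : ℝ) :
    HasDerivAt (G T γ lam) (logDerivG T γ lam t * G T γ lam t) t := by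
  rw [logDerivG, div_mul_cancel₀ _ (G_ne_zero t), deriv_G]
  exact hasDerivAt_G' t

lemma continuous_G : Continuous (G T γ lam) :=
  continuous_iff_continuousAt.2 fun t => (hasDerivAt_G t).continuousAt

lemma continuous_logDerivG : Continuous (logDerivG T γ lam) := by
  have h : deriv (G T γ lam) = fun t => -√(γ / lam) * Real.sinh (√(γ / lam) * (T - t)) :=
    funext deriv_G
  refine Continuous.div ?_ continuous_G G_ne_zero
  rw [h]
  fun_prop

/-- The Riccati equation solved by `G' / G`. -/
lemma hasDerivAt_logDerivG (hγ : 0 ≤ γ) (hlam : 0 ≤ lam) (t : ℝ) :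
    HasDerivAt (logDerivG T γ lam) (γ / lam - logDerivG T γ lam t ^ 2) t := by
  have h : HasDerivAt (fun t => √(γ / lam) * (T - t)) (√(γ / lam) * (-1)) t :=
    ((hasDerivAt_id t).const_sub T).const_mul _
  have h1 : HasDerivAt (deriv (G T γ lam)) (γ / lam * G T γ lam t) t := by
    have h2 := h.sinh.const_mul (-√(γ / lam))
    have h3 : deriv (G T γ lam) = fun t => -√(γ / lam) * Real.sinh (√(γ / lam) * (T - t)) :=
      funext deriv_G
    rw [h3]
    convert! h2 using 1
    have := Real.sq_sqrt (div_nonneg hγ hlam)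
    rw [G]
    linear_combination -Real.cosh (√(γ / lam) * (T - t)) * this
  have hG := G_ne_zero (T := T) (γ := γ) (lam := lam) t
  have h4 := h1.div (hasDerivAt_G t) hG
  convert! h4 using 1
  rw [logDerivG]
  field_simp

lemma logDerivG_terminal : logDerivG T γ lam T = 0 := by
  simp [logDerivG, deriv_G]

lemma hasRateOn_G : HasRateOn T (G T γ lam) (fun t => logDerivG T γ lam t * G T γ lam t) :=
  .of_hasDerivAt hasDerivAt_G (continuous_logDerivG.mul continuous_G)

lemma hasRateOn_inv_G :
    HasRateOn T (fun t => (G T γ lam t)⁻¹) (fun t => -(logDerivG T γ lam t / G T γ lam t)) := by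
  refine .of_hasDerivAt (fun t => ?_) (continuous_logDerivG.div continuous_G G_ne_zero).neg
  have hG := G_ne_zero (T := T) (γ := γ) (lam := lam) t
  convert! (hasDerivAt_G t).inv hG using 1
  field_simp

end Discount

/-! ### Pathwise identities -/

section Pathwise

variable {T γ lam : ℝ} {φ φ' μ ξ : ℝ → ℝ}

/-- Discounting by `G` turns the rate `φ'` into the discounted control `φ' - (G'/G) φ`. -/
lemma HasRateOn.discount (hT : 0 ≤ T) (hφ : HasRateOn T φ φ') :
    HasRateOn T (fun t => φ t * (G T γ lam t)⁻¹)
      (fun t => (φ' t - logDerivG T γ lam t * φ t) / G T γ lam t) :=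
  (hφ.mul hT hasRateOn_inv_G).congr_rate fun t => by
    have hG := G_ne_zero (T := T) (γ := γ) (lam := lam) t
    field_simp
    ring

/-- The quadratic costs of a path in terms of its control `φ' - (G'/G) φ`. The boundary term at `T`
vanishes since `G' T = 0`. -/
lemma HasRateOn.integral_cost (hT : 0 ≤ T) (hγ : 0 ≤ γ) (hlam : 0 < lam) (hφ : HasRateOn T φ φ')
    (hsq : IntervalIntegrable (fun t => (φ' t - logDerivG T γ lam t * φ t) ^ 2) volume 0 T) :
    ∫ t in (0 : ℝ)..T, (γ / 2 * φ t ^ 2 + lam / 2 * φ' t ^ 2) =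
      (∫ t in (0 : ℝ)..T, lam / 2 * (φ' t - logDerivG T γ lam t * φ t) ^ 2)
        - lam / 2 * logDerivG T γ lam 0 * φ 0 ^ 2 := by
  have hg : HasRateOn T (logDerivG T γ lam) (fun t => γ / lam - logDerivG T γ lam t ^ 2) :=
    .of_hasDerivAt (hasDerivAt_logDerivG hγ hlam.le)
      (continuous_const.sub (continuous_logDerivG.pow 2))
  have h := hg.mul hT (hφ.mul hT hφ)
  have h1 := h.eq T ⟨hT, le_rfl⟩
  simp only [logDerivG_terminal, zero_mul] at h1
  -- the costs are `(lam/2) (φ' - (G'/G) φ)²` plus `lam/2` times the rate of `(G'/G) φ²`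
  have h2 : ∀ t, γ / 2 * φ t ^ 2 + lam / 2 * φ' t ^ 2 =
      lam / 2 * (φ' t - logDerivG T γ lam t * φ t) ^ 2 + lam / 2 *
        ((γ / lam - logDerivG T γ lam t ^ 2) * (φ t * φ t)
          + logDerivG T γ lam t * (φ' t * φ t + φ t * φ' t)) := fun t => by
    field_simp
    ring
  simp_rw [h2]
  rw [intervalIntegral.integral_add (hsq.const_mul _) (h.integrable.const_mul _),
    intervalIntegral.integral_const_mul (lam / 2) (fun t =>
      (γ / lam - logDerivG T γ lam t ^ 2) * (φ t * φ t)
          + logDerivG T γ lam t * (φ' t * φ t + φ t * φ' t))]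
  linear_combination -lam / 2 * h1

/-- Summation of the drift gains by parts, against the discounted future drift. -/
lemma HasRateOn.integral_mul_drift (hT : 0 ≤ T) (hlam : lam ≠ 0) (hφ : HasRateOn T φ φ')
    (hμ : IntervalIntegrable μ volume 0 T) :
    ∫ t in (0 : ℝ)..T, φ t * μ t =
      lam * (∫ t in (0 : ℝ)..T, (φ' t - logDerivG T γ lam t * φ t) *
        ∫ u in t..T, G T γ lam u / G T γ lam t * (μ u / lam))
      + lam * φ 0 * ∫ u in (0 : ℝ)..T, G T γ lam u / G T γ lam 0 * (μ u / lam) := by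
  set w : ℝ → ℝ := fun u => G T γ lam u * (μ u / lam) with hw
  have hwi : IntervalIntegrable w volume 0 T :=
    (hμ.div_const lam).continuousOn_mul continuous_G.continuousOn
  have hsig : ∀ t, ∫ u in t..T, G T γ lam u / G T γ lam t * (μ u / lam) =
      (G T γ lam t)⁻¹ * ∫ u in t..T, w u := fun t => by
    rw [← intervalIntegral.integral_const_mul]
    congr 1; ext u; rw [hw]; ring
  have hfut : HasRateOn T (fun t => ∫ u in t..T, w u) (fun t => -w t) := by
    refine ⟨hwi.neg, fun t ht => ?_⟩
    rw [intervalIntegral.integral_neg, ← intervalIntegral.integral_add_adjacent_intervals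
      (a := 0) (b := t) (c := T) (hwi.mono_set ?_) (hwi.mono_set ?_)]
    · ring
    · rw [uIcc_of_le ht.1, uIcc_of_le hT]; exact Icc_subset_Icc_right ht.2
    · rw [uIcc_of_le ht.2, uIcc_of_le hT]; exact Icc_subset_Icc_left ht.1
  have hprod := (hφ.discount (γ := γ) (lam := lam) hT).mul hT hfut
  have h1 := hprod.eq T ⟨hT, le_rfl⟩
  have hfc : IntervalIntegrable (fun t => φ t * μ t) volume 0 T :=
    hμ.continuousOn_mul (by rw [uIcc_of_le hT]; exact hφ.continuousOn hT)
  -- the product of `φ/G` and the future weighted drift vanishes at `T`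
  have h2 : ∀ t, (φ' t - logDerivG T γ lam t * φ t) *
      (∫ u in t..T, G T γ lam u / G T γ lam t * (μ u / lam)) =
      ((φ' t - logDerivG T γ lam t * φ t) / G T γ lam t * (∫ u in t..T, w u) +
        φ t * (G T γ lam t)⁻¹ * -w t) + lam⁻¹ * (φ t * μ t) := fun t => by
    rw [hsig, hw]
    have hG := G_ne_zero (T := T) (γ := γ) (lam := lam) t
    field_simp
    ring
  simp_rw [h2]
  rw [intervalIntegral.integral_add hprod.integrable (hfc.const_mul _),
    intervalIntegral.integral_const_mul, hsig]
  simp only [intervalIntegral.integral_same, mul_zero] at h1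
  have h3 : lam * lam⁻¹ = 1 := mul_inv_cancel₀ hlam
  linear_combination lam * h1 - (∫ t in (0 : ℝ)..T, φ t * μ t) * h3

/-- Variation of constants: the linear equation `φ' = (G'/G) φ + ξ` integrates to the explicit
formula for `φ`. -/
lemma HasRateOn.eq_variation_of_constants (hT : 0 ≤ T) (hφ : HasRateOn T φ φ')
    (hode : ∀ᵐ t ∂(volume.restrict (Icc (0 : ℝ) T)), φ' t = logDerivG T γ lam t * φ t + ξ t)
    {t : ℝ} (ht : t ∈ Icc (0 : ℝ) T) :
    φ t = G T γ lam t / G T γ lam 0 * φ 0 +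
      ∫ s in (0 : ℝ)..t, G T γ lam t / G T γ lam s * ξ s := by
  have h := (hφ.discount (γ := γ) (lam := lam) hT).eq t ht
  have hint : ∫ s in (0 : ℝ)..t, G T γ lam t / G T γ lam s * ξ s =
      G T γ lam t * ∫ s in (0 : ℝ)..t, (φ' s - logDerivG T γ lam s * φ s) / G T γ lam s := by
    rw [← intervalIntegral.integral_const_mul]
    refine intervalIntegral.integral_congr_ae ?_
    filter_upwards [(ae_restrict_iff' measurableSet_Icc).1 hode] with s hs hst
    rw [uIoc_of_le ht.1] at hst
    rw [hs ⟨hst.1.le, hst.2.trans ht.2⟩]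
    ring
  have hG := G_ne_zero (T := T) (γ := γ) (lam := lam) t
  rw [hint, ← sub_eq_iff_eq_add'.2 h]
  field_simp
  ring

/-- Conversely, the explicit formula solves the linear equation. -/
lemma hasRateOn_variation_of_constants (hT : 0 ≤ T) (hξ : IntervalIntegrable ξ volume 0 T)
    (a : ℝ) :
    HasRateOn T
      (fun t => G T γ lam t / G T γ lam 0 * a +
        ∫ s in (0 : ℝ)..t, G T γ lam t / G T γ lam s * ξ s)
      (fun t => logDerivG T γ lam t * (G T γ lam t / G T γ lam 0 * a +
        ∫ s in (0 : ℝ)..t, G T γ lam t / G T γ lam s * ξ s) + ξ t) := by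
  have h : HasRateOn T (fun t => a / G T γ lam 0 + ∫ s in (0 : ℝ)..t, (G T γ lam s)⁻¹ * ξ s)
      (fun t => (G T γ lam t)⁻¹ * ξ t) :=
    ⟨hξ.continuousOn_mul (continuous_G.inv₀ G_ne_zero).continuousOn, fun t _ => by simp⟩
  have heq : ∀ t, G T γ lam t / G T γ lam 0 * a +
        (∫ s in (0 : ℝ)..t, G T γ lam t / G T γ lam s * ξ s) =
      G T γ lam t * (a / G T γ lam 0 + ∫ s in (0 : ℝ)..t, (G T γ lam s)⁻¹ * ξ s) := fun t => by
    rw [mul_add, ← intervalIntegral.integral_const_mul]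
    congr 1
    · ring
    · congr 1; ext s; ring
  simp_rw [heq]
  refine (hasRateOn_G.mul hT h).congr_rate fun t => ?_
  have hG := G_ne_zero (T := T) (γ := γ) (lam := lam) t
  field_simp

end Pathwise

/-! ### Progressively measurable processes -/

section Measurability

variable {Ω : Type*}

lemma measurable_map_fst {α β : Type*} [MeasurableSpace α] [MeasurableSpace β]
    (m : MeasurableSpace Ω) {g : α → β} (hg : Measurable g) :
    Measurable (fun p : α × Ω => (g p.1, p.2)) := by
  fun_prop

/-- The primitive of a jointly measurable function is jointly measurable. -/
lemma stronglyMeasurable_intervalIntegral [MeasurableSpace Ω] {f : ℝ × Ω → ℝ}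
    (hf : StronglyMeasurable f) (a : ℝ) :
    StronglyMeasurable (fun p : ℝ × Ω => ∫ u in a..p.1, f (u, p.2)) := by
  have hf' : StronglyMeasurable (fun q : (ℝ × Ω) × ℝ => f (q.2, q.1.2)) :=
    hf.comp_measurable (by fun_prop)
  have key : ∀ l r : ℝ × Ω → ℝ, Measurable l → Measurable r →
      StronglyMeasurable (fun p : ℝ × Ω => ∫ u in Ioc (l p) (r p), f (u, p.2)) := by
    intro l r hl hr
    have hs : MeasurableSet {q : (ℝ × Ω) × ℝ | q.2 ∈ Ioc (l q.1) (r q.1)} :=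
      (measurableSet_lt (hl.comp measurable_fst) measurable_snd).inter
        (measurableSet_le measurable_snd (hr.comp measurable_fst))
    convert! (hf'.indicator hs).integral_prod_right' (ν := volume) using 2 with p
    rw [← integral_indicator measurableSet_Ioc]
    rfl
  exact (key (fun _ => a) Prod.fst measurable_const measurable_fst).sub
    (key Prod.fst (fun _ => a) measurable_fst measurable_const)

variable [mΩ : MeasurableSpace Ω] {ℱ : Filtration ℝ mΩ} {T : ℝ} {φ ψ : ℝ → Ω → ℝ}

namespace ProgressiveOn

lemma add (hφ : ProgressiveOn ℱ T φ) (hψ : ProgressiveOn ℱ T ψ) :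
    ProgressiveOn ℱ T (fun t ω => φ t ω + ψ t ω) :=
  fun t ht => (hφ t ht).add (hψ t ht)

lemma sub (hφ : ProgressiveOn ℱ T φ) (hψ : ProgressiveOn ℱ T ψ) :
    ProgressiveOn ℱ T (fun t ω => φ t ω - ψ t ω) :=
  fun t ht => (hφ t ht).sub (hψ t ht)

lemma mul (hφ : ProgressiveOn ℱ T φ) (hψ : ProgressiveOn ℱ T ψ) :
    ProgressiveOn ℱ T (fun t ω => φ t ω * ψ t ω) :=
  fun t ht => (hφ t ht).mul (hψ t ht)

lemma deterministic {g : ℝ → ℝ} (hg : Measurable g) :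
    ProgressiveOn ℱ T (fun t (_ : Ω) => g t) := fun t _ =>
  hg.stronglyMeasurable.comp_measurable
    (@Measurable.comp _ _ _ (_) _ _ _ _ measurable_subtype_coe
      (@measurable_fst _ _ _ (ℱ t)))

lemma stronglyMeasurable {E : Type*} [TopologicalSpace E] {φ : ℝ → Ω → E}
    (hφ : ProgressiveOn ℱ T φ) {t : ℝ} (ht : t ∈ Icc (0 : ℝ) T) :
    StronglyMeasurable[ℱ t] (φ t) :=
  (hφ t ht).comp_measurable (g := fun ω => ((⟨t, ht.1, le_rfl⟩ : Icc (0 : ℝ) t), ω))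
    (@measurable_prodMk_left _ _ _ (ℱ t) _)

/-- Extending a progressively measurable process from `[0, t]` to all times by freezing it at the
end points gives a jointly `ℱ t`-measurable function. -/
lemma stronglyMeasurable_clamp {E : Type*} [TopologicalSpace E] {φ : ℝ → Ω → E}
    (hφ : ProgressiveOn ℱ T φ) {t : ℝ} (ht : t ∈ Icc (0 : ℝ) T) :
    StronglyMeasurable[(inferInstance : MeasurableSpace ℝ).prod (ℱ t)]
      (fun p : ℝ × Ω => φ (projIcc 0 t ht.1 p.1) p.2) := by
  exact (hφ t ht).comp_measurable
    (measurable_map_fst (ℱ t) (continuous_projIcc (h := ht.1)).measurable)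

lemma aestronglyMeasurable {E : Type*} [TopologicalSpace E] {φ : ℝ → Ω → E} {P : Measure Ω}
    [SFinite P] (hT : 0 ≤ T) (hφ : ProgressiveOn ℱ T φ) :
    AEStronglyMeasurable (fun x : ℝ × Ω => φ x.1 x.2) (timeProd P T) := by
  have h := hφ.stronglyMeasurable_clamp (right_mem_Icc.2 hT)
  have h' := (h.mono (sup_le_sup_left
    (MeasurableSpace.comap_mono (ℱ.le T)) _)).aestronglyMeasurable (μ := timeProd P T)
  refine h'.congr ?_
  have := (Measure.quasiMeasurePreserving_fst (μ := volume.restrict (Icc (0 : ℝ) T))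
    (ν := P)).ae (ae_restrict_mem measurableSet_Icc)
  filter_upwards [this] with x hx
  rw [projIcc_of_mem _ hx]

/-- Time integrals of progressively measurable processes are progressively measurable, with no
integrability needed as the Bochner integral is measurable in parameters. -/
lemma integral (hφ : ProgressiveOn ℱ T φ) :
    ProgressiveOn ℱ T (fun t ω => ∫ s in (0 : ℝ)..t, φ s ω) := by
  intro t ht
  have h := @stronglyMeasurable_intervalIntegral _ (ℱ t) _ (hφ.stronglyMeasurable_clamp ht) 0
  have h2 := h.comp_measurable
    (measurable_map_fst (ℱ t) (measurable_subtype_coe (p := (· ∈ Icc (0 : ℝ) t))))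
  convert! h2 using 2 with p
  refine intervalIntegral.integral_congr fun s hs => ?_
  rw [uIcc_of_le p.1.2.1] at hs
  simp only
  rw [projIcc_of_mem ht.1 ⟨hs.1, hs.2.trans p.1.2.2⟩]

end ProgressiveOn

end Measurability

/-! ### A progressively measurable version of a closed martingale -/

section Martingale

variable {Ω : Type*} {m₁ m₂ : MeasurableSpace Ω} [mΩ : MeasurableSpace Ω] {P : Measure Ω}
  [IsProbabilityMeasure P]

/-- Pythagoras for nested conditional expectations. -/
lemma integral_sq_condExp_sub (h₁₂ : m₁ ≤ m₂) (h₂ : m₂ ≤ mΩ)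
    {N : Ω → ℝ} (hN : MemLp N 2 P) :
    ∫ ω, (P[N|m₂] ω - P[N|m₁] ω) ^ 2 ∂P = ∫ ω, P[N|m₂] ω ^ 2 ∂P - ∫ ω, P[N|m₁] ω ^ 2 ∂P := by
  have hX : MemLp (P[N|m₂]) 2 P := hN.condExp one_le_two
  have hY : MemLp (P[N|m₁]) 2 P := hN.condExp one_le_two
  -- the smaller conditional expectation is pulled out, and the tower property applied
  have hcross : ∫ ω, P[N|m₁] ω * P[N|m₂] ω ∂P = ∫ ω, P[N|m₁] ω ^ 2 ∂P := by
    have h := condExp_mul_of_stronglyMeasurable_left (μ := P) (m := m₁)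
      (stronglyMeasurable_condExp (f := N)) (hY.integrable_mul hX) integrable_condExp
    have h' := condExp_condExp_of_le (μ := P) (f := N) h₁₂ h₂
    calc ∫ ω, P[N|m₁] ω * P[N|m₂] ω ∂P
        = ∫ ω, (P[P[N|m₁] * P[N|m₂]|m₁]) ω ∂P := (integral_condExp (h₁₂.trans h₂)).symm
      _ = ∫ ω, P[N|m₁] ω ^ 2 ∂P := by
        refine integral_congr_ae ?_
        filter_upwards [h, h'] with ω h1 h2
        rw [h1, Pi.mul_apply, h2, sq]
  have hexp : ∀ ω, (P[N|m₂] ω - P[N|m₁] ω) ^ 2 =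
      P[N|m₂] ω ^ 2 + P[N|m₁] ω ^ 2 - 2 * (P[N|m₁] ω * P[N|m₂] ω) := fun ω => by ring
  simp_rw [hexp]
  have hXY : Integrable (fun ω => P[N|m₁] ω * P[N|m₂] ω) P := hY.integrable_mul hX
  have hadd : Integrable (fun ω => P[N|m₂] ω ^ 2 + P[N|m₁] ω ^ 2) P :=
    hX.integrable_sq.add hY.integrable_sq
  rw [integral_sub hadd (hXY.const_mul 2), integral_add hX.integrable_sq hY.integrable_sq, integral_const_mul, hcross]
  ring

lemma integral_sq_condExp_mono (h₁₂ : m₁ ≤ m₂) (h₂ : m₂ ≤ mΩ)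
    {N : Ω → ℝ} (hN : MemLp N 2 P) :
    ∫ ω, P[N|m₁] ω ^ 2 ∂P ≤ ∫ ω, P[N|m₂] ω ^ 2 ∂P := by
  have h := integral_sq_condExp_sub h₁₂ h₂ hN
  have h' : 0 ≤ ∫ ω, (P[N|m₂] ω - P[N|m₁] ω) ^ 2 ∂P := integral_nonneg fun ω => sq_nonneg _
  linarith

/-- The largest multiple of `2⁻ⁿ` which is at most `s`. -/
noncomputable def dyadicFloor (n : ℕ) (s : ℝ) : ℝ := ⌊2 ^ n * s⌋ / 2 ^ n

lemma dyadicFloor_le (n : ℕ) (s : ℝ) : dyadicFloor n s ≤ s := by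
  rw [dyadicFloor, div_le_iff₀ (by positivity), mul_comm s]
  exact Int.floor_le _

lemma dyadicFloor_mono (s : ℝ) : Monotone (fun n => dyadicFloor n s) := by
  refine monotone_nat_of_le_succ fun n => ?_
  rw [dyadicFloor, dyadicFloor, div_le_div_iff₀ (by positivity) (by positivity), pow_succ,
    ← mul_assoc, mul_right_comm]
  refine mul_le_mul_of_nonneg_right ?_ (by positivity)
  have : ((⌊2 ^ n * s⌋ * 2 : ℤ) : ℝ) ≤ (⌊2 ^ n * 2 * s⌋ : ℤ) := by
    refine Int.cast_le.2 (Int.le_floor.2 ?_)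
    push_cast
    linarith [Int.floor_le ((2 : ℝ) ^ n * s)]
  push_cast at this
  exact this

lemma tendsto_dyadicFloor (s : ℝ) : Tendsto (fun n => dyadicFloor n s) atTop (𝓝 s) := by
  have h : Tendsto (fun n : ℕ => s - (1 / 2 : ℝ) ^ n) atTop (𝓝 s) := by
    simpa using (tendsto_pow_atTop_nhds_zero_of_lt_one (r := (1 / 2 : ℝ)) (by norm_num)
      (by norm_num)).const_sub s
  refine tendsto_of_tendsto_of_tendsto_of_le_of_le h tendsto_const_nhds (fun n => ?_)
    (fun n => dyadicFloor_le n s)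
  change s - (1 / 2 : ℝ) ^ n ≤ dyadicFloor n s
  have h2 : (0 : ℝ) < 2 ^ n := by positivity
  rw [dyadicFloor, le_div_iff₀ h2, sub_mul, one_div, inv_pow, inv_mul_cancel₀ h2.ne']
  linarith [Int.lt_floor_add_one ((2 : ℝ) ^ n * s)]

variable {ℱ : Filtration ℝ mΩ} {T : ℝ} {N : Ω → ℝ}

/-- Away from the discontinuities of `s ↦ E[E_s[N]²]`, the martingale `E_s[N]` is the almost sure
limit of its values at dyadic times from the left, by Lévy's upward theorem. -/
lemma tendsto_condExp_dyadicFloor (hN : MemLp N 2 P) {s : ℝ}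
    (hs : ContinuousAt (fun s => ∫ ω, P[N|ℱ s] ω ^ 2 ∂P) s) :
    ∀ᵐ ω ∂P, Tendsto (fun n => P[N|ℱ (dyadicFloor n s)] ω) atTop (𝓝 (P[N|ℱ s] ω)) := by
  let 𝒢 : Filtration ℕ mΩ :=
    { seq := fun n => ℱ (dyadicFloor n s)
      mono' := fun i j hij => ℱ.mono (dyadicFloor_mono s hij)
      le' := fun n => ℱ.le _ }
  have hle : ⨆ n, 𝒢 n ≤ ℱ s := iSup_le fun n => ℱ.mono (dyadicFloor_le n s)
  have hlim : Tendsto (fun n => ∫ ω, P[N|ℱ (dyadicFloor n s)] ω ^ 2 ∂P) atTop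
      (𝓝 (∫ ω, P[N|ℱ s] ω ^ 2 ∂P)) := hs.tendsto.comp (tendsto_dyadicFloor s)
  -- the second moments of `E_s[N]` and of the limit agree, so that these coincide by Pythagoras
  have h1 : ∫ ω, P[N|ℱ s] ω ^ 2 ∂P ≤ ∫ ω, P[N|⨆ n, 𝒢 n] ω ^ 2 ∂P :=
    le_of_tendsto' hlim fun n =>
      integral_sq_condExp_mono (le_iSup (fun n => 𝒢 n) n) (hle.trans (ℱ.le s)) hN
  have h2 := integral_sq_condExp_sub hle (ℱ.le s) hN
  have h3 : ∫ ω, (P[N|ℱ s] ω - P[N|⨆ n, 𝒢 n] ω) ^ 2 ∂P = 0 :=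
    le_antisymm (by linarith) (integral_nonneg fun ω => sq_nonneg _)
  have h4 := (integral_eq_zero_iff_of_nonneg (fun ω => sq_nonneg _)
    (((hN.condExp one_le_two).sub (hN.condExp one_le_two)).integrable_sq)).1 h3
  filter_upwards [tendsto_ae_condExp (ℱ := 𝒢) (μ := P) N, h4] with ω ht hω
  have : P[N|ℱ s] ω = P[N|⨆ n, 𝒢 n] ω := sub_eq_zero.1 (pow_eq_zero_iff two_ne_zero |>.1 hω)
  rw [this]
  exact ht

lemma progressiveOn_condExp_dyadicFloor {P : Measure Ω} (n : ℕ) :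
    ProgressiveOn ℱ T (fun s => P[N|ℱ (dyadicFloor n s)]) := by
  intro t _
  -- cutting at `t` makes all the countably many values `ℱ t`-measurable and changes nothing for
  -- times in `[0, t]`
  have hF : ∀ k : ℤ, Measurable[ℱ t] (P[N|ℱ (min (k / 2 ^ n) t)]) := fun k =>
    (stronglyMeasurable_condExp.mono (ℱ.mono (min_le_right _ _))).measurable
  have h1 : Measurable[(inferInstance : MeasurableSpace ℤ).prod (ℱ t)]
      (fun q : ℤ × Ω => P[N|ℱ (min (q.1 / 2 ^ n) t)] q.2) :=
    @measurable_from_prod_countable_right _ _ _ _ (ℱ t) _ _ _ _ hF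
  have h2 := measurable_map_fst (ℱ t) (g := fun s : Icc (0 : ℝ) t => ⌊2 ^ n * (s : ℝ)⌋)
    (Int.measurable_floor.comp (measurable_subtype_coe.const_mul _))
  have h3 := @Measurable.comp _ _ _ (_) (_) _ _ _ h1 h2
  convert! @Measurable.stronglyMeasurable _ _ (_) _ _ _ _ _ _ h3 using 1
  ext p
  have : dyadicFloor n p.1 = min (((⌊2 ^ n * (p.1 : ℝ)⌋ : ℤ) : ℝ) / 2 ^ n) t :=
    (min_eq_left ((dyadicFloor_le n p.1).trans p.1.2.2)).symm
  simp only [Function.comp_apply]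
  rw [← this]

open Classical in
/-- Modifying a progressively measurable process at countably many times, by random variables
adapted to the filtration, preserves progressive measurability. -/
lemma ProgressiveOn.piecewise_countable {φ ψ : ℝ → Ω → ℝ} {D : Set ℝ} (hD : D.Countable)
    (hψ : ProgressiveOn ℱ T ψ) (hφ : ∀ s, StronglyMeasurable[ℱ s] (φ s)) :
    ProgressiveOn ℱ T (fun s => if s ∈ D then φ s else ψ s) := by
  intro t ht
  refine @Measurable.stronglyMeasurable _ _ (_) _ _ _ _ _ _ ?_
  intro B hB
  have hset : (fun p : Icc (0 : ℝ) t × Ω => (if (p.1 : ℝ) ∈ D then φ p.1 else ψ p.1) p.2) ⁻¹' B =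
      (⋃ d ∈ ((↑) ⁻¹' D : Set (Icc (0 : ℝ) t)), {d} ×ˢ (φ d ⁻¹' B)) ∪
        (((↑) ⁻¹' D : Set (Icc (0 : ℝ) t))ᶜ ×ˢ univ ∩
          (fun p : Icc (0 : ℝ) t × Ω => ψ p.1 p.2) ⁻¹' B) := by
    ext p
    by_cases hp : (p.1 : ℝ) ∈ D
    · simp only [mem_preimage, hp, if_true, mem_union, mem_iUnion, mem_prod, mem_singleton_iff,
        mem_inter_iff, mem_compl_iff, not_true_eq_false, false_and, or_false, exists_prop]
      exact ⟨fun h => ⟨p.1, hp, rfl, h⟩, fun ⟨d, _, hd, h⟩ => hd ▸ h⟩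
    · simp only [mem_preimage, hp, if_false, mem_union, mem_iUnion, mem_prod, mem_singleton_iff,
        mem_inter_iff, mem_compl_iff, not_false_eq_true, true_and, mem_univ, exists_prop]
      exact ⟨Or.inr, fun h => h.resolve_left fun ⟨d, hd, hd', _⟩ => hp (hd' ▸ hd)⟩
  have hD' : ((↑) ⁻¹' D : Set (Icc (0 : ℝ) t)).Countable :=
    hD.preimage Subtype.val_injective
  rw [hset]
  refine @MeasurableSet.union _ (_) _ _ (@MeasurableSet.biUnion _ _ (_) _ _ hD' fun d _ => ?_)
    (@MeasurableSet.inter _ (_) _ _ ?_ ((hψ t ht).measurable hB))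
  · exact @MeasurableSet.prod _ _ _ (ℱ t) _ _ (measurableSet_singleton d)
      (((hφ d).mono (ℱ.mono d.2.2)).measurable hB)
  · exact @MeasurableSet.prod _ _ _ (ℱ t) _ _ hD'.measurableSet.compl MeasurableSet.univ

/-- The martingale closed by a square-integrable random variable has a progressively measurable
version, for any filtration: the limit along dyadic times from the left is a version except at the
countably many discontinuities of the increasing function `s ↦ E[E_s[N]²]`, where the conditional
expectation itself is used. -/
theorem exists_progressiveOn_condExp (hN : MemLp N 2 P) :
    ∃ Y : ℝ → Ω → ℝ, ProgressiveOn ℱ T Y ∧ ∀ s, Y s =ᵐ[P] P[N|ℱ s] := by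
  classical
  obtain ⟨D, hDdef⟩ : ∃ D : Set ℝ, D = {s | ¬ ContinuousAt (fun s => ∫ ω, P[N|ℱ s] ω ^ 2 ∂P) s} :=
    ⟨_, rfl⟩
  have hD : D.Countable := by
    rw [hDdef]
    exact Monotone.countable_not_continuousAt fun s t hst =>
      integral_sq_condExp_mono (ℱ.mono hst) (ℱ.le t) hN
  refine ⟨fun s => if s ∈ D then P[N|ℱ s] else
    fun ω => limUnder atTop (fun n => P[N|ℱ (dyadicFloor n s)] ω),
    ProgressiveOn.piecewise_countable hD (fun t ht => ?_) (fun s => stronglyMeasurable_condExp),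
    fun s => ?_⟩
  · exact @StronglyMeasurable.limUnder _ _ _ (_) _ _ _ _ _ _ _ fun n =>
      progressiveOn_condExp_dyadicFloor n t ht
  · by_cases hs : s ∈ D
    · simp [hs]
    · simp only [hs, if_false]
      filter_upwards [tendsto_condExp_dyadicFloor hN (not_not.1 (hDdef ▸ hs))] with ω hω
      exact hω.limUnder_eq

end Martingale

/-! ### The Itô integral has mean zero -/

section Ito

variable {Ω : Type*} [mΩ : MeasurableSpace Ω] {P : Measure Ω} {ℱ : Filtration ℝ mΩ} {T : ℝ} {m : ℕ} {W : ℝ → Ω → EuclideanSpace ℝ (Fin m)}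

namespace IsBrownianMotionOn

variable {s t : ℝ}

lemma integrable_increment (hW : IsBrownianMotionOn ℱ P T W) (hs : 0 ≤ s) (hst : s ≤ t) (ht : t ≤ T) :
    Integrable (fun ω => W t ω - W s ω) P := by
  have h := hW.law s t hs hst ht
  have h2 : Integrable id (P.map (fun ω => W t ω - W s ω)) := by
    rw [h.map_eq]
    exact IsGaussian.integrable_id
  exact h2.comp_aemeasurable h.aemeasurable

lemma integral_increment (hW : IsBrownianMotionOn ℱ P T W) (hs : 0 ≤ s) (hst : s ≤ t) (ht : t ≤ T) :
    ∫ ω, (W t ω - W s ω) ∂P = 0 := by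
  rw [(hW.law s t hs hst ht).integral_eq, integral_id_multivariateGaussian]

lemma integral_inner_increment [IsProbabilityMeasure P] (hW : IsBrownianMotionOn ℱ P T W) (hs : 0 ≤ s) (hst : s ≤ t)
    (ht : t ≤ T)
    {c : Ω → EuclideanSpace ℝ (Fin m)} (hc : StronglyMeasurable[ℱ s] c)
    {C : ℝ} (hC : ∀ ω, ‖c ω‖ ≤ C) :
    Integrable (fun ω => inner ℝ (c ω) (W t ω - W s ω)) P ∧
      ∫ ω, inner ℝ (c ω) (W t ω - W s ω) ∂P = 0 := by
  have hcm : AEStronglyMeasurable c P := (hc.mono (ℱ.le s)).aestronglyMeasurable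
  have hci : Integrable c P := .of_bound hcm C (ae_of_all _ hC)
  have hd := hW.integrable_increment hs hst ht
  have hind : IndepFun c (fun ω => W t ω - W s ω) P :=
    (IndepFun_iff_Indep _ _ _).2
      (indep_of_indep_of_le_left (hW.indep s t hs hst ht) hc.measurable.comap_le)
  refine ⟨?_, ?_⟩
  · refine (hd.norm.const_mul C).mono' (hcm.inner hd.aestronglyMeasurable) (ae_of_all _ fun ω => ?_)
    exact (norm_inner_le_norm _ _).trans (mul_le_mul_of_nonneg_right (hC ω) (norm_nonneg _))
  · have h := hind.integral_bilin hci hd (innerSL ℝ)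
    rw [hW.integral_increment hs hst ht, map_zero] at h
    exact h

end IsBrownianMotionOn

variable [IsProbabilityMeasure P]

lemma SimpleProcess.integrable_integral_and_integral_eq_zero (hW : IsBrownianMotionOn ℱ P T W)
    (H : SimpleProcess ℱ T m) :
    Integrable (H.integral W T) P ∧ ∫ ω, H.integral W T ω ∂P = 0 := by
  obtain ⟨C, hC⟩ := H.coeff_bdd
  have key : ∀ k ∈ Finset.range H.n, Integrable (fun ω => inner ℝ (H.coeff k ω)
        (W (min (H.time (k + 1)) T) ω - W (min (H.time k) T) ω)) P ∧
      ∫ ω, inner ℝ (H.coeff k ω)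
        (W (min (H.time (k + 1)) T) ω - W (min (H.time k) T) ω) ∂P = 0 := by
    intro k hk
    have hk' := Finset.mem_range.1 hk
    have h0 := H.time_mem k hk'.le
    have h1 := H.time_mem (k + 1) hk'
    rw [min_eq_left h0.2, min_eq_left h1.2]
    exact hW.integral_inner_increment h0.1 (H.time_mono k.le_succ) h1.2 (H.coeff_meas k hk')
      (hC k hk')
  refine ⟨integrable_finsetSum _ fun k hk => (key k hk).1, ?_⟩
  simp only [SimpleProcess.integral]
  rw [integral_finsetSum _ fun k hk => (key k hk).1]
  exact Finset.sum_eq_zero fun k hk => (key k hk).2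

lemma IsItoIntegral.integrable_and_integral_eq_zero (hT : 0 ≤ T)
    (hW : IsBrownianMotionOn ℱ P T W) {H : ℝ → Ω → EuclideanSpace ℝ (Fin m)} {I : ℝ → Ω → ℝ}
    (hI : IsItoIntegral ℱ P T W H I) :
    Integrable (I T) P ∧ ∫ ω, I T ω ∂P = 0 := by
  obtain ⟨-, hmeas, -, Hn, -, hlim⟩ := hI
  have hTT : T ∈ Icc 0 T := right_mem_Icc.2 hT
  have hIm : AEStronglyMeasurable (I T) P := (hmeas T hTT).mono (ℱ.le T)
  have hS := fun n => (Hn n).integrable_integral_and_integral_eq_zero hW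
  have hle : ∀ n, eLpNorm (fun ω => (Hn n).integral W T ω - I T ω) 1 P ≤
      eLpNorm (fun ω => (Hn n).integral W T ω - I T ω) 2 P := fun n =>
    eLpNorm_le_eLpNorm_of_exponent_le one_le_two ((hS n).1.aestronglyMeasurable.sub hIm)
  have hlim1 : Tendsto (fun n => eLpNorm (fun ω => (Hn n).integral W T ω - I T ω) 1 P) atTop
      (𝓝 0) :=
    tendsto_of_tendsto_of_tendsto_of_le_of_le tendsto_const_nhds (hlim T hTT)
      (fun n => zero_le) hle
  have hInt : Integrable (I T) P := by
    obtain ⟨n, hn⟩ := (hlim1.eventually_lt_const ENNReal.zero_lt_top).exists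
    have hd : Integrable (fun ω => (Hn n).integral W T ω - I T ω) P :=
      memLp_one_iff_integrable.1 ⟨(hS n).1.aestronglyMeasurable.sub hIm, hn⟩
    refine ((hS n).1.sub hd).congr (ae_of_all _ fun ω => ?_)
    simp
  refine ⟨hInt, ?_⟩
  simp_rw [eLpNorm_one_eq_lintegral_enorm] at hlim1
  have h := tendsto_integral_of_L1 (I T) hIm (Eventually.of_forall fun n => (hS n).1) hlim1
  simp_rw [fun n => (hS n).2] at h
  exact tendsto_nhds_unique h tendsto_const_nhds

/-- The terminal value of the Itô integral is integrable with mean zero. When an Itô integral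
exists this is the mean-zero property of `L²`-limits of elementary integrals. Its existence is not
needed, since the conventional value zero of `itoIntegral` also has mean zero. -/
lemma integrable_and_integral_itoIntegral (hT : 0 ≤ T) (hW : IsBrownianMotionOn ℱ P T W)
    (H : ℝ → Ω → EuclideanSpace ℝ (Fin m)) :
    Integrable (itoIntegral ℱ P T W H T) P ∧ ∫ ω, itoIntegral ℱ P T W H T ω ∂P = 0 := by
  by_cases h : ∃ I, IsItoIntegral ℱ P T W H I
  · rw [itoIntegral, dif_pos h]
    exact h.choose_spec.integrable_and_integral_eq_zero hT hW
  · rw [itoIntegral, dif_neg h]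
    exact ⟨integrable_zero _ _ _, by simp⟩

end Ito

/-! ### Estimates for time integrals -/

section Estimates

variable {Ω : Type*} [mΩ : MeasurableSpace Ω] {P : Measure Ω} {T : ℝ}

lemma ae_timeProd_mem_Icc : ∀ᵐ x ∂(timeProd P T), x.1 ∈ Icc (0 : ℝ) T :=
  (Measure.quasiMeasurePreserving_fst (μ := volume.restrict (Icc (0 : ℝ) T))
    (ν := P)).ae (ae_restrict_mem measurableSet_Icc)

lemma ae_timeProd_of_ae {p : Ω → Prop} (h : ∀ᵐ ω ∂P, p ω) : ∀ᵐ x ∂(timeProd P T), p x.2 :=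
  (Measure.quasiMeasurePreserving_snd (μ := volume.restrict (Icc (0 : ℝ) T)) (ν := P)).ae h

variable [IsProbabilityMeasure P]

instance : IsFiniteMeasure (timeProd P T) := by
  rw [timeProd]
  infer_instance

lemma ae_ae_of_ae_timeProd {p : ℝ × Ω → Prop} (h : ∀ᵐ x ∂(timeProd P T), p x) :
    ∀ᵐ ω ∂P, ∀ᵐ t ∂(volume.restrict (Icc (0 : ℝ) T)), p (t, ω) := by
  have h' : ∀ᵐ y ∂(P.prod (volume.restrict (Icc (0 : ℝ) T))), p y.swap :=
    Measure.measurePreserving_swap.quasiMeasurePreserving.ae h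
  exact Measure.ae_ae_of_ae_prod h'

lemma ae_intervalIntegrable (hT : 0 ≤ T) {f : ℝ × Ω → ℝ} (hf : Integrable f (timeProd P T)) :
    ∀ᵐ ω ∂P, IntervalIntegrable (fun t => f (t, ω)) volume 0 T := by
  filter_upwards [hf.prod_left_ae] with ω hω
  rwa [intervalIntegrable_iff_integrableOn_Icc_of_le hT]

lemma integrable_intervalIntegral (hT : 0 ≤ T) {f : ℝ × Ω → ℝ}
    (hf : Integrable f (timeProd P T)) : Integrable (fun ω => ∫ t in (0 : ℝ)..T, f (t, ω)) P := by
  simp_rw [intervalIntegral.integral_of_le hT, ← integral_Icc_eq_integral_Ioc]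
  exact hf.integral_prod_right

lemma integral_timeProd (hT : 0 ≤ T) {f : ℝ × Ω → ℝ} (hf : Integrable f (timeProd P T)) :
    ∫ x, f x ∂(timeProd P T) = ∫ ω, (∫ t in (0 : ℝ)..T, f (t, ω)) ∂P := by
  simp_rw [intervalIntegral.integral_of_le hT, ← integral_Icc_eq_integral_Ioc]
  exact integral_prod_symm f hf

/-- The time integral `∫₀ᵀ |f_t| dt` of an `L⁴` process is in `L⁴`, by Hölder's
inequality in time. -/
lemma memLp_integral_norm {f : ℝ × Ω → ℝ} (hf : MemLp f 4 (timeProd P T)) :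
    MemLp (fun ω => ∫ t in Icc (0 : ℝ) T, ‖f (t, ω)‖) 4 P := by
  have hfm : AEStronglyMeasurable f ((volume.restrict (Icc (0 : ℝ) T)).prod P) :=
    hf.aestronglyMeasurable
  refine ⟨hfm.norm.prod_swap.integral_prod_right', ?_⟩
  have h4 : ∀ y : ℝ≥0∞, y ^ (4 : ℝ≥0∞).toReal = y ^ 4 := fun y => by
    rw [← ENNReal.rpow_natCast]
    norm_num
  set c : ℝ≥0∞ := volume.restrict (Icc (0 : ℝ) T) univ ^ ((3 : ℝ) / 4) with hc
  have hcfin : c ^ 4 < ∞ := by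
    refine ENNReal.pow_lt_top (ENNReal.rpow_lt_top_of_nonneg (by norm_num) ?_)
    exact measure_ne_top _ _
  have hfin : ∫⁻ x, ‖f x‖ₑ ^ 4 ∂(timeProd P T) < ∞ := by
    have := lintegral_rpow_enorm_lt_top_of_eLpNorm_lt_top (p := 4) (by norm_num) (by norm_num)
      hf.2
    simpa only [h4] using this
  have hbound : ∀ᵐ ω ∂P, ‖∫ t in Icc (0 : ℝ) T, ‖f (t, ω)‖‖ₑ ^ 4 ≤
      c ^ 4 * ∫⁻ t in Icc (0 : ℝ) T, ‖f (t, ω)‖ₑ ^ 4 := by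
    filter_upwards [hfm.prod_swap.prodMk_left] with ω hω
    have h1 := eLpNorm_le_eLpNorm_mul_rpow_measure_univ (p := 1) (q := 4) (by norm_num) hω
    rw [eLpNorm_one_eq_lintegral_enorm,
      eLpNorm_eq_lintegral_rpow_enorm_toReal (by norm_num) (by norm_num)] at h1
    have h2 : ‖∫ t in Icc (0 : ℝ) T, ‖f (t, ω)‖‖ₑ ≤ ∫⁻ t in Icc (0 : ℝ) T, ‖f (t, ω)‖ₑ := by
      refine (enorm_integral_le_lintegral_enorm _).trans_eq ?_
      simp
    refine (pow_le_pow_left' (h2.trans h1) 4).trans_eq ?_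
    simp_rw [h4]
    rw [mul_pow, mul_comm]
    congr 1
    · rw [hc]; norm_num
    · rw [← ENNReal.rpow_natCast, ← ENNReal.rpow_mul]
      norm_num
  rw [eLpNorm_lt_top_iff_lintegral_rpow_enorm_lt_top (by norm_num) (by norm_num)]
  simp_rw [h4]
  calc ∫⁻ ω, ‖∫ t in Icc (0 : ℝ) T, ‖f (t, ω)‖‖ₑ ^ 4 ∂P
      ≤ ∫⁻ ω, (c ^ 4 * ∫⁻ t in Icc (0 : ℝ) T, ‖f (t, ω)‖ₑ ^ 4) ∂P := lintegral_mono_ae hbound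
    _ = c ^ 4 * ∫⁻ x, ‖f x‖ₑ ^ 4 ∂(timeProd P T) := by
      rw [lintegral_const_mul' _ _ hcfin.ne, timeProd,
        lintegral_prod_symm _ (hfm.enorm.pow_const 4)]
    _ < ∞ := ENNReal.mul_lt_top hcfin hfin

/-- A process dominated by `∫₀ᵀ |f_t| dt` for an `L⁴` process `f` is in `L⁴`. -/
lemma memLp_of_norm_le_integral_norm {f F : ℝ × Ω → ℝ} (hf : MemLp f 4 (timeProd P T))
    (hF : AEStronglyMeasurable F (timeProd P T))
    (h : ∀ᵐ x ∂(timeProd P T), ‖F x‖ ≤ ∫ t in Icc (0 : ℝ) T, ‖f (t, x.2)‖) :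
    MemLp F 4 (timeProd P T) := by
  refine MemLp.mono ((memLp_integral_norm hf).comp_snd
    (volume.restrict (Icc (0 : ℝ) T))) hF ?_
  filter_upwards [h] with x hx
  exact hx.trans (le_abs_self _)

/-- The pathwise bound that verifies the hypothesis of `memLp_of_norm_le_integral_norm`. -/
lemma norm_intervalIntegral_le {f : ℝ → ℝ} {s t : ℝ}
    (hf : IntegrableOn f (Icc 0 T)) (hs : s ∈ Icc 0 T) (ht : t ∈ Icc 0 T) :
    ‖∫ u in s..t, f u‖ ≤ ∫ u in Icc (0 : ℝ) T, ‖f u‖ :=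
  intervalIntegral.norm_integral_le_integral_norm_uIoc.trans
    (setIntegral_mono_set hf.norm (ae_of_all _ fun _ => norm_nonneg _)
      (uIoc_subset_uIcc.trans
        ((convex_Icc 0 T).ordConnected.uIcc_subset hs ht)).eventuallyLE)

end Estimates

variable {Ω : Type*} [mΩ : MeasurableSpace Ω] {P : Measure Ω}
  {ℱ : Filtration ℝ mΩ} {T γ lam a : ℝ} {m : ℕ}

/-! ### `L⁴` processes -/

section ProgLp

lemma exists_abs_le_of_continuous {g : ℝ → ℝ} (hg : Continuous g) :
    ∃ C, ∀ t ∈ Icc (0 : ℝ) T, |g t| ≤ C :=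
  isCompact_Icc.exists_bound_of_continuousOn hg.continuousOn

lemma one_le_G (t : ℝ) : 1 ≤ G T γ lam t := Real.one_le_cosh _

lemma memLp_continuous_mul {g : ℝ → ℝ} (hg : Continuous g) {f : ℝ × Ω → ℝ} {p : ℝ≥0∞}
    (hf : MemLp f p (timeProd P T)) : MemLp (fun x => g x.1 * f x) p (timeProd P T) := by
  obtain ⟨C, hC⟩ := exists_abs_le_of_continuous (T := T) hg
  refine MemLp.of_le_mul (c := C) hf
    ((hg.measurable.comp measurable_fst).aestronglyMeasurable.mul hf.aestronglyMeasurable) ?_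
  filter_upwards [ae_timeProd_mem_Icc] with x hx
  rw [norm_mul]
  exact mul_le_mul_of_nonneg_right (hC _ hx) (norm_nonneg _)

lemma IsProgLp.continuous_mul {g : ℝ → ℝ} (hg : Continuous g) {φ : ℝ → Ω → ℝ}
    (hφ : IsProgLp 4 ℱ P T φ) : IsProgLp 4 ℱ P T (fun t ω => g t * φ t ω) :=
  ⟨(ProgressiveOn.deterministic hg.measurable).mul hφ.1, memLp_continuous_mul hg hφ.2⟩

variable [IsProbabilityMeasure P]

lemma IsProgLp.memLp_two {φ : ℝ → Ω → ℝ} (hφ : IsProgLp 4 ℱ P T φ) :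
    MemLp (fun x : ℝ × Ω => φ x.1 x.2) 2 (timeProd P T) :=
  hφ.2.mono_exponent (by norm_num)

lemma IsProgLp.integrable {φ : ℝ → Ω → ℝ} (hφ : IsProgLp 4 ℱ P T φ) :
    Integrable (fun x : ℝ × Ω => φ x.1 x.2) (timeProd P T) :=
  hφ.memLp_two.integrable one_le_two

/-- Tonelli: domination of the `L⁴` norms at each time gives membership in `𝓛⁴`. -/
lemma memLp_timeProd_of_eLpNorm_le {X Y : ℝ × Ω → ℝ}
    (hX : AEStronglyMeasurable X (timeProd P T)) (hY : MemLp Y 4 (timeProd P T))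
    (h : ∀ t ∈ Icc (0 : ℝ) T,
      eLpNorm (fun ω => X (t, ω)) 4 P ≤ eLpNorm (fun ω => Y (t, ω)) 4 P) :
    MemLp X 4 (timeProd P T) := by
  refine ⟨hX, ?_⟩
  have h4 : (4 : ℝ≥0∞).toReal = 4 := by norm_num
  have hY' := hY.2
  rw [eLpNorm_lt_top_iff_lintegral_rpow_enorm_lt_top (by norm_num) (by norm_num), h4,
    timeProd] at hY' ⊢
  rw [lintegral_prod _ (hX.enorm.pow_const _)]
  rw [lintegral_prod _ (hY.aestronglyMeasurable.enorm.pow_const _)] at hY'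
  refine lt_of_le_of_lt (lintegral_mono_ae ?_) hY'
  filter_upwards [ae_restrict_mem measurableSet_Icc] with t ht
  have := h t ht
  rw [eLpNorm_eq_lintegral_rpow_enorm_toReal (by norm_num) (by norm_num),
    eLpNorm_eq_lintegral_rpow_enorm_toReal (by norm_num) (by norm_num), h4] at this
  exact (ENNReal.rpow_le_rpow_iff (by norm_num)).1 this

end ProgLp

/-! ### The signal -/

section Signal

variable (S : ItoPriceProcess ℱ P T m)

/-- The discounted future drift `∫ₜᵀ (G(u)/G(t)) (μ_u/lam) du`, whose conditional expectation is
the signal. -/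
noncomputable def futureDrift (γ lam t : ℝ) (ω : Ω) : ℝ :=
  ∫ u in t..T, G T γ lam u / G T γ lam t * (S.μ u ω / lam)

/-- The weighted drift `G(u) μ_u/lam`. -/
noncomputable def weightedDrift (γ lam u : ℝ) (ω : Ω) : ℝ :=
  G T γ lam u * (S.μ u ω / lam)

lemma isProgLp_weightedDrift : IsProgLp 4 ℱ P T (weightedDrift S γ lam) := by
  have h := S.drift_mem.continuous_mul (g := fun u => G T γ lam u * lam⁻¹)
    (continuous_G.mul continuous_const)
  convert! h using 3 with u ω
  rw [weightedDrift]
  ring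

lemma futureDrift_eq (t : ℝ) (ω : Ω) :
    futureDrift S γ lam t ω = (G T γ lam t)⁻¹ * ∫ u in t..T, weightedDrift S γ lam u ω := by
  rw [futureDrift, ← intervalIntegral.integral_const_mul]
  congr 1; ext u; rw [weightedDrift]; ring

lemma aestronglyMeasurable_futureDrift (hT : 0 ≤ T) :
    AEStronglyMeasurable (fun x : ℝ × Ω => futureDrift S γ lam x.1 x.2) (timeProd P T) := by
  have h := (isProgLp_weightedDrift S (γ := γ) (lam := lam)).1.stronglyMeasurable_clamp
    (right_mem_Icc.2 hT)
  have h' := stronglyMeasurable_intervalIntegral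
    (h.mono (sup_le_sup_left (MeasurableSpace.comap_mono (ℱ.le T)) _)) T
  have hG : StronglyMeasurable (fun x : ℝ × Ω => (G T γ lam x.1)⁻¹) :=
    ((continuous_G.inv₀ G_ne_zero).measurable.comp measurable_fst).stronglyMeasurable
  refine (hG.mul h'.neg).aestronglyMeasurable.congr ?_
  filter_upwards [ae_timeProd_mem_Icc] with x hx
  rw [futureDrift_eq, intervalIntegral.integral_symm]
  simp only [Pi.mul_apply, Pi.neg_apply]
  congr 2
  refine intervalIntegral.integral_congr fun s hs => ?_
  rw [uIcc_of_ge hx.2] at hs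
  rw [projIcc_of_mem hT ⟨hx.1.trans hs.1, hs.2⟩]

variable [IsProbabilityMeasure P]

lemma memLp_futureDrift (hT : 0 ≤ T) :
    MemLp (fun x : ℝ × Ω => futureDrift S γ lam x.1 x.2) 4 (timeProd P T) := by
  have hw := isProgLp_weightedDrift S (γ := γ) (lam := lam)
  refine memLp_of_norm_le_integral_norm hw.2 (aestronglyMeasurable_futureDrift S hT) ?_
  filter_upwards [ae_timeProd_mem_Icc, ae_timeProd_of_ae hw.integrable.prod_left_ae] with x hx hi
  have h1 := norm_intervalIntegral_le hi hx (right_mem_Icc.2 hT)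
  rw [futureDrift_eq, norm_mul, norm_inv, Real.norm_of_nonneg (G_pos _).le]
  exact (mul_le_of_le_one_left (norm_nonneg _) (inv_le_one_of_one_le₀ (one_le_G _))).trans h1

/-- The conditional expectations of the discounted future drift have a progressively measurable
version: the future drift is a martingale minus its accumulated past. -/
theorem exists_isSignal (hT : 0 ≤ T) : ∃ ξ : ℝ → Ω → ℝ, IsSignal S γ lam ξ := by
  have hw := isProgLp_weightedDrift S (γ := γ) (lam := lam)
  have hpast : ∀ s ∈ Icc 0 T, MemLp (fun ω => ∫ u in (0 : ℝ)..s, weightedDrift S γ lam u ω) 4 P := by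
    intro s hs
    refine (memLp_integral_norm hw.2).mono
      ((hw.1.integral.stronglyMeasurable hs).mono (ℱ.le s)).aestronglyMeasurable ?_
    filter_upwards [hw.integrable.prod_left_ae] with ω hω
    exact (norm_intervalIntegral_le hω (left_mem_Icc.2 hT) hs).trans (le_abs_self _)
  have hN := hpast T (right_mem_Icc.2 hT)
  obtain ⟨Y, hY, hYN⟩ := exists_progressiveOn_condExp (ℱ := ℱ) (T := T)
    (hN.mono_exponent (p := 2) (by norm_num))
  refine ⟨fun s ω => (G T γ lam s)⁻¹ * (Y s ω - ∫ u in (0 : ℝ)..s, weightedDrift S γ lam u ω),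
    (ProgressiveOn.deterministic (continuous_G.inv₀ G_ne_zero).measurable).mul
      (hY.sub hw.1.integral), fun s hs => ?_⟩
  set A : Ω → ℝ := fun ω => ∫ u in (0 : ℝ)..s, weightedDrift S γ lam u ω with hA
  set N : Ω → ℝ := fun ω => ∫ u in (0 : ℝ)..T, weightedDrift S γ lam u ω
  have hsplit : futureDrift S γ lam s =ᵐ[P] (G T γ lam s)⁻¹ • (N - A) := by
    filter_upwards [ae_intervalIntegrable hT hw.integrable] with ω hω
    have h1 : uIcc 0 s ⊆ uIcc 0 T := by
      rw [uIcc_of_le hs.1, uIcc_of_le hT]; exact Icc_subset_Icc_right hs.2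
    have h2 : uIcc s T ⊆ uIcc 0 T := by
      rw [uIcc_of_le hs.2, uIcc_of_le hT]; exact Icc_subset_Icc_left hs.1
    rw [futureDrift_eq, Pi.smul_apply, smul_eq_mul, Pi.sub_apply, eq_sub_of_add_eq'
      (intervalIntegral.integral_add_adjacent_intervals (hω.mono_set h1) (hω.mono_set h2))]
  have hNi : Integrable N P := hN.integrable (by norm_num)
  have hAi : Integrable A P := (hpast s hs).integrable (by norm_num)
  have hcA : P[A|ℱ s] = A :=
    condExp_of_stronglyMeasurable (ℱ.le s) (hw.1.integral.stronglyMeasurable hs) hAi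
  filter_upwards [hYN s, condExp_congr_ae (m := ℱ s) hsplit,
    condExp_smul (μ := P) (G T γ lam s)⁻¹ (N - A) (ℱ s), condExp_sub hNi hAi (ℱ s)]
    with ω h1 h2 h3 h4
  change _ = (P[futureDrift S γ lam s|ℱ s]) ω
  rw [h2, h3, Pi.smul_apply, smul_eq_mul, h4, Pi.sub_apply, hcA, h1]

variable {S} {ξ : ℝ → Ω → ℝ}

lemma IsSignal.isProgLp (hT : 0 ≤ T) (hξ : IsSignal S γ lam ξ) : IsProgLp 4 ℱ P T ξ := by
  refine ⟨hξ.1, memLp_timeProd_of_eLpNorm_le (hξ.1.aestronglyMeasurable hT)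
    (memLp_futureDrift S (γ := γ) (lam := lam) hT) fun t ht => ?_⟩
  exact (eLpNorm_congr_ae (hξ.2 t ht)).trans_le (eLpNorm_condExp_le_eLpNorm _ (by norm_num))

/-- Against progressively measurable processes, the future drift may be replaced by the signal,
by the tower property. -/
lemma IsSignal.integral_mul_futureDrift (hT : 0 ≤ T) (hξ : IsSignal S γ lam ξ)
    {k : ℝ → Ω → ℝ} (hk : IsProgLp 4 ℱ P T k) :
    ∫ x, k x.1 x.2 * futureDrift S γ lam x.1 x.2 ∂(timeProd P T) =
      ∫ x, k x.1 x.2 * ξ x.1 x.2 ∂(timeProd P T) := by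
  have hΞ : MemLp (fun x : ℝ × Ω => futureDrift S γ lam x.1 x.2) 2 (timeProd P T) :=
    (memLp_futureDrift S hT).mono_exponent (by norm_num)
  have h1 : Integrable (fun x : ℝ × Ω => k x.1 x.2 * futureDrift S γ lam x.1 x.2) (timeProd P T) :=
    hk.memLp_two.integrable_mul hΞ
  have h2 : Integrable (fun x : ℝ × Ω => k x.1 x.2 * ξ x.1 x.2) (timeProd P T) :=
    hk.memLp_two.integrable_mul (hξ.isProgLp hT).memLp_two
  rw [timeProd] at h1 h2 ⊢
  rw [integral_prod _ h1, integral_prod _ h2]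
  refine integral_congr_ae ?_
  filter_upwards [h1.prod_right_ae, (hΞ.integrable one_le_two).prod_right_ae,
    ae_restrict_mem measurableSet_Icc] with t ht1 ht2 ht
  have h3 := condExp_mul_of_stronglyMeasurable_left (hk.1.stronglyMeasurable ht) ht1 ht2
  calc ∫ ω, k t ω * futureDrift S γ lam t ω ∂P
      = ∫ ω, (P[k t * futureDrift S γ lam t|ℱ t]) ω ∂P := (integral_condExp (ℱ.le t)).symm
    _ = ∫ ω, k t ω * ξ t ω ∂P := by
      refine integral_congr_ae ?_
      filter_upwards [h3, hξ.2 t ht] with ω h4 h5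
      rw [h4, Pi.mul_apply, h5]
      rfl

end Signal

/-! ### Completing the square -/

section Objective

variable {S : ItoPriceProcess ℱ P T m} {φ φ' ξ : ℝ → Ω → ℝ}

lemma IsPortfolio.isProgLp_control (h : IsPortfolio ℱ P T a φ φ') :
    IsProgLp 4 ℱ P T (fun t ω => φ' t ω - logDerivG T γ lam t * φ t ω) := by
  have h1 := h.1.continuous_mul (continuous_logDerivG (T := T) (γ := γ) (lam := lam))
  exact ⟨h.2.1.1.sub h1.1, h.2.1.2.sub h1.2⟩

variable [IsProbabilityMeasure P]

lemma IsPortfolio.ae_hasRateOn (hT : 0 ≤ T) (h : IsPortfolio ℱ P T a φ φ') :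
    ∀ᵐ ω ∂P, φ 0 ω = a ∧ HasRateOn T (fun t => φ t ω) (fun t => φ' t ω) := by
  filter_upwards [h.2.2, ae_intervalIntegrable hT h.2.1.integrable] with ω h1 h2
  have h0 : φ 0 ω = a := by simpa using h1 0 (left_mem_Icc.2 hT)
  exact ⟨h0, h2, fun t ht => by rw [h1 t ht, h0]⟩

/-- The objective as a function of the control `φ' - (G'/G) φ` alone. -/
lemma IsPortfolio.objective_eq_control (hT : 0 ≤ T) (hγ : 0 ≤ γ) (hlam : 0 < lam)
    (h : IsPortfolio ℱ P T a φ φ') :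
    objective S γ lam φ φ' =
      lam * (∫ x, (φ' x.1 x.2 - logDerivG T γ lam x.1 * φ x.1 x.2) *
        futureDrift S γ lam x.1 x.2 ∂(timeProd P T))
      - lam / 2 * (∫ x, (φ' x.1 x.2 - logDerivG T γ lam x.1 * φ x.1 x.2) ^ 2 ∂(timeProd P T))
      + ∫ ω, (lam * a * futureDrift S γ lam 0 ω + lam / 2 * logDerivG T γ lam 0 * a ^ 2) ∂P := by
  have hk := h.isProgLp_control (γ := γ) (lam := lam)
  have hk2 : Integrable (fun x : ℝ × Ω =>
      (φ' x.1 x.2 - logDerivG T γ lam x.1 * φ x.1 x.2) ^ 2) (timeProd P T) :=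
    hk.memLp_two.integrable_sq
  have hkΞ : Integrable (fun x : ℝ × Ω => (φ' x.1 x.2 - logDerivG T γ lam x.1 * φ x.1 x.2) *
      futureDrift S γ lam x.1 x.2) (timeProd P T) :=
    hk.memLp_two.integrable_mul
      ((memLp_futureDrift S hT).mono_exponent (p := 2) (by norm_num))
  have hφμ : Integrable (fun x : ℝ × Ω => φ x.1 x.2 * S.μ x.1 x.2) (timeProd P T) :=
    h.1.memLp_two.integrable_mul S.drift_mem.memLp_two
  have hφ2 : Integrable (fun x : ℝ × Ω => γ / 2 * φ x.1 x.2 ^ 2) (timeProd P T) :=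
    h.1.memLp_two.integrable_sq.const_mul _
  have hφ'2 : Integrable (fun x : ℝ × Ω => lam / 2 * φ' x.1 x.2 ^ 2) (timeProd P T) :=
    h.2.1.memLp_two.integrable_sq.const_mul _
  have hI := integrable_and_integral_itoIntegral hT S.brownian (fun t ω => φ t ω • S.ν t ω)
  set I := itoIntegral ℱ P T S.W (fun t ω => φ t ω • S.ν t ω) T
  obtain ⟨X, hX⟩ : ∃ X : Ω → ℝ, X = fun ω => ∫ t in (0 : ℝ)..T,
    (φ' t ω - logDerivG T γ lam t * φ t ω) * futureDrift S γ lam t ω := ⟨_, rfl⟩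
  obtain ⟨Y, hY⟩ : ∃ Y : Ω → ℝ, Y = fun ω => ∫ t in (0 : ℝ)..T,
    (φ' t ω - logDerivG T γ lam t * φ t ω) ^ 2 := ⟨_, rfl⟩
  have iX : Integrable (fun ω => lam * X ω) P := by
    rw [hX]; exact (integrable_intervalIntegral hT hkΞ).const_mul lam
  have iY : Integrable (fun ω => lam / 2 * Y ω) P := by
    rw [hY]; exact (integrable_intervalIntegral hT hk2).const_mul (lam / 2)
  have iXY : Integrable (fun ω => lam * X ω - lam / 2 * Y ω) P := iX.sub iY
  have iXYI : Integrable (fun ω => lam * X ω - lam / 2 * Y ω + I ω) P := iXY.add hI.1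
  have hpath : ∀ᵐ ω ∂P, S.gains φ ω - (∫ t in (0 : ℝ)..T, γ / 2 * φ t ω ^ 2)
        - (∫ t in (0 : ℝ)..T, lam / 2 * φ' t ω ^ 2)
      - (lam * X ω - lam / 2 * Y ω + I ω) =
      lam * a * futureDrift S γ lam 0 ω + lam / 2 * logDerivG T γ lam 0 * a ^ 2 := by
    filter_upwards [h.ae_hasRateOn hT, ae_intervalIntegrable hT S.drift_mem.integrable,
      ae_intervalIntegrable hT hk2, ae_intervalIntegrable hT hφ2, ae_intervalIntegrable hT hφ'2]
      with ω hω hμ hkω hφω hφ'ω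
    have e1 := hω.2.integral_mul_drift (γ := γ) hT hlam.ne' hμ
    have e2 := hω.2.integral_cost hT hγ hlam hkω
    rw [intervalIntegral.integral_add hφω hφ'ω, intervalIntegral.integral_const_mul (lam / 2)
      (fun t => (φ' t ω - logDerivG T γ lam t * φ t ω) ^ 2)] at e2
    rw [hω.1] at e1 e2
    simp only [ItoPriceProcess.gains, futureDrift, hX, hY] at e1 e2 ⊢
    linear_combination e1 - e2
  have hJ : Integrable (fun ω => S.gains φ ω - (∫ t in (0 : ℝ)..T, γ / 2 * φ t ω ^ 2)
      - ∫ t in (0 : ℝ)..T, lam / 2 * φ' t ω ^ 2) P :=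
    (((integrable_intervalIntegral hT hφμ).add hI.1).sub
      (integrable_intervalIntegral hT hφ2)).sub (integrable_intervalIntegral hT hφ'2)
  have e := integral_congr_ae hpath
  rw [integral_sub hJ iXYI, integral_add iXY hI.1, integral_sub iX iY,
    integral_const_mul, integral_const_mul, hI.2] at e
  have eX := integral_timeProd hT hkΞ
  have eY := integral_timeProd hT hk2
  rw [objective, eX, eY, ← e, hX, hY]
  ring

/-- The value of the objective at a portfolio whose rate satisfies the random ODE. -/
noncomputable def optimalValue (S : ItoPriceProcess ℱ P T m) (γ lam a : ℝ) (ξ : ℝ → Ω → ℝ) : ℝ :=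
  lam / 2 * (∫ x, ξ x.1 x.2 ^ 2 ∂(timeProd P T)) +
    ∫ ω, (lam * a * futureDrift S γ lam 0 ω + lam / 2 * logDerivG T γ lam 0 * a ^ 2) ∂P

lemma IsPortfolio.memLp_sub_rate (hT : 0 ≤ T) (hξ : IsSignal S γ lam ξ)
    (h : IsPortfolio ℱ P T a φ φ') :
    MemLp (fun x : ℝ × Ω => φ' x.1 x.2 - rate T γ lam ξ φ x.1 x.2) 2 (timeProd P T) := by
  refine ((h.isProgLp_control (γ := γ) (lam := lam)).memLp_two.sub
    (hξ.isProgLp hT).memLp_two).ae_eq (ae_of_all _ fun x => ?_)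
  simp only [Pi.sub_apply, rate, logDerivG]
  ring

/-- The objective falls short of its optimal value by the mean squared deviation of the rate from
the right-hand side of the random ODE. -/
theorem IsPortfolio.objective_eq (hT : 0 ≤ T) (hγ : 0 ≤ γ) (hlam : 0 < lam)
    (hξ : IsSignal S γ lam ξ) (h : IsPortfolio ℱ P T a φ φ') :
    objective S γ lam φ φ' = optimalValue S γ lam a ξ -
      lam / 2 * ∫ x, (φ' x.1 x.2 - rate T γ lam ξ φ x.1 x.2) ^ 2 ∂(timeProd P T) := by
  have hk := h.isProgLp_control (γ := γ) (lam := lam)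
  have hξ2 := (hξ.isProgLp hT).memLp_two
  have hkξ : Integrable (fun x : ℝ × Ω => (φ' x.1 x.2 - logDerivG T γ lam x.1 * φ x.1 x.2) *
      ξ x.1 x.2) (timeProd P T) := hk.memLp_two.integrable_mul hξ2
  have hk2 : Integrable (fun x : ℝ × Ω =>
      (φ' x.1 x.2 - logDerivG T γ lam x.1 * φ x.1 x.2) ^ 2) (timeProd P T) :=
    hk.memLp_two.integrable_sq
  -- `φ' - rate` is the control minus the signal
  have hdiff : ∫ x, (φ' x.1 x.2 - rate T γ lam ξ φ x.1 x.2) ^ 2 ∂(timeProd P T) =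
      ∫ x, (φ' x.1 x.2 - logDerivG T γ lam x.1 * φ x.1 x.2) ^ 2 ∂(timeProd P T) +
      ∫ x, ξ x.1 x.2 ^ 2 ∂(timeProd P T) -
      2 * ∫ x, (φ' x.1 x.2 - logDerivG T γ lam x.1 * φ x.1 x.2) * ξ x.1 x.2 ∂(timeProd P T) := by
    have hsum : Integrable (fun x : ℝ × Ω =>
        (φ' x.1 x.2 - logDerivG T γ lam x.1 * φ x.1 x.2) ^ 2 + ξ x.1 x.2 ^ 2) (timeProd P T) :=
      hk2.add hξ2.integrable_sq
    rw [← integral_add hk2 hξ2.integrable_sq, ← integral_const_mul,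
      ← integral_sub hsum (hkξ.const_mul 2)]
    refine integral_congr_ae (ae_of_all _ fun x => ?_)
    simp only [rate, logDerivG]
    ring
  rw [h.objective_eq_control hT hγ hlam, hξ.integral_mul_futureDrift hT hk, hdiff, optimalValue]
  ring

end Objective

/-! ### The explicit portfolio -/

section Optimality

variable [IsProbabilityMeasure P] {S : ItoPriceProcess ℱ P T m} {φ φ' ξ : ℝ → Ω → ℝ}

lemma isProgLp_position (hT : 0 ≤ T) (hξ : IsProgLp 4 ℱ P T ξ) :
    IsProgLp 4 ℱ P T (position T γ lam a ξ) := by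
  have hinv : Continuous fun s => (G T γ lam s)⁻¹ := continuous_G.inv₀ G_ne_zero
  have hdisc := hξ.continuous_mul hinv
  have heq : position T γ lam a ξ = fun t ω => G T γ lam t * (a / G T γ lam 0) +
      G T γ lam t * ∫ s in (0 : ℝ)..t, (G T γ lam s)⁻¹ * ξ s ω := by
    ext t ω
    rw [position, ← intervalIntegral.integral_const_mul]
    congr 1
    · ring
    · congr 1; ext s; ring
  have hprog : ProgressiveOn ℱ T (fun t ω => ∫ s in (0 : ℝ)..t, (G T γ lam s)⁻¹ * ξ s ω) :=
    hdisc.1.integral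
  have hint : IsProgLp 4 ℱ P T (fun t ω => ∫ s in (0 : ℝ)..t, (G T γ lam s)⁻¹ * ξ s ω) := by
    refine ⟨hprog, memLp_of_norm_le_integral_norm hdisc.2 (hprog.aestronglyMeasurable hT) ?_⟩
    filter_upwards [ae_timeProd_mem_Icc, ae_timeProd_of_ae hdisc.integrable.prod_left_ae]
      with x hx hi
    exact norm_intervalIntegral_le hi (left_mem_Icc.2 hT) hx
  have hconst : IsProgLp 4 ℱ P T (fun (_ : ℝ) (_ : Ω) => a / G T γ lam 0) :=
    ⟨ProgressiveOn.deterministic measurable_const, memLp_const _⟩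
  have h1 := hconst.continuous_mul (continuous_G (T := T) (γ := γ) (lam := lam))
  have h2 := hint.continuous_mul (continuous_G (T := T) (γ := γ) (lam := lam))
  rw [heq]
  exact ⟨h1.1.add h2.1, h1.2.add h2.2⟩

lemma isPortfolio_position (hT : 0 ≤ T) (hξ : IsProgLp 4 ℱ P T ξ) :
    IsPortfolio ℱ P T a (position T γ lam a ξ) (rate T γ lam ξ (position T γ lam a ξ)) := by
  have hpos := isProgLp_position (γ := γ) (lam := lam) (a := a) hT hξ
  have h1 := hpos.continuous_mul (continuous_logDerivG (T := T) (γ := γ) (lam := lam))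
  refine ⟨hpos, ⟨h1.1.add hξ.1, h1.2.add hξ.2⟩, ?_⟩
  filter_upwards [ae_intervalIntegrable hT hξ.integrable] with ω hω t ht
  have h2 := (hasRateOn_variation_of_constants (γ := γ) (lam := lam) hT hω a).eq t ht
  simp only [intervalIntegral.integral_same, add_zero, div_self (G_ne_zero 0), one_mul] at h2
  exact h2

/-- Optimality is characterized by the random ODE for the rate. -/
theorem IsPortfolio.isOptimal_iff (hT : 0 ≤ T) (hγ : 0 ≤ γ) (hlam : 0 < lam)
    (hξ : IsSignal S γ lam ξ) (h : IsPortfolio ℱ P T a φ φ') :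
    IsOptimal S γ lam a φ φ' ↔
      ∀ᵐ x ∂(timeProd P T), φ' x.1 x.2 = rate T γ lam ξ φ x.1 x.2 := by
  have hJ := h.objective_eq hT hγ hlam hξ
  have hnonneg : ∀ ψ ψ' : ℝ → Ω → ℝ,
      0 ≤ ∫ x, (ψ' x.1 x.2 - rate T γ lam ξ ψ x.1 x.2) ^ 2 ∂(timeProd P T) :=
    fun ψ ψ' => integral_nonneg fun x => sq_nonneg _
  constructor
  · intro hopt
    have hle := hopt.2 _ _ (isPortfolio_position (γ := γ) (lam := lam) hT (hξ.isProgLp hT))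
    rw [hJ, (isPortfolio_position hT (hξ.isProgLp hT)).objective_eq hT hγ hlam hξ] at hle
    simp only [sub_self, ne_eq, OfNat.ofNat_ne_zero, not_false_eq_true, zero_pow,
      integral_zero, mul_zero, sub_zero] at hle
    have h0 : ∫ x, (φ' x.1 x.2 - rate T γ lam ξ φ x.1 x.2) ^ 2 ∂(timeProd P T) = 0 := by
      refine le_antisymm ?_ (hnonneg φ φ')
      by_contra! hpos
      have := mul_pos (half_pos hlam) hpos
      linarith
    filter_upwards [(integral_eq_zero_iff_of_nonneg (fun x => sq_nonneg _)
      (h.memLp_sub_rate hT hξ).integrable_sq).1 h0] with x hx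
    exact sub_eq_zero.1 ((pow_eq_zero_iff two_ne_zero).1 hx)
  · intro hode
    refine ⟨h, fun ψ ψ' hψ => ?_⟩
    have h0 : ∫ x, (φ' x.1 x.2 - rate T γ lam ξ φ x.1 x.2) ^ 2 ∂(timeProd P T) = 0 := by
      refine integral_eq_zero_of_ae ?_
      filter_upwards [hode] with x hx
      simp [hx]
    rw [hJ, hψ.objective_eq hT hγ hlam hξ, h0]
    have := mul_nonneg (half_pos hlam).le (hnonneg ψ ψ')
    linarith

/-- A portfolio whose rate satisfies the random ODE is the explicit one. -/
lemma IsPortfolio.ae_eq_position (hT : 0 ≤ T) (h : IsPortfolio ℱ P T a φ φ')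
    (hode : ∀ᵐ x ∂(timeProd P T), φ' x.1 x.2 = rate T γ lam ξ φ x.1 x.2) :
    ∀ᵐ x ∂(timeProd P T), φ x.1 x.2 = position T γ lam a ξ x.1 x.2 := by
  have hω : ∀ᵐ ω ∂P, ∀ t ∈ Icc (0 : ℝ) T, φ t ω = position T γ lam a ξ t ω := by
    filter_upwards [h.ae_hasRateOn hT, ae_ae_of_ae_timeProd hode] with ω h1 h2 t ht
    have h3 := h1.2.eq_variation_of_constants (γ := γ) (lam := lam) (ξ := fun s => ξ s ω) hT h2 ht
    rw [h1.1] at h3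
    exact h3
  filter_upwards [ae_timeProd_of_ae hω, ae_timeProd_mem_Icc] with x h1 h2
  exact h1 _ h2

end Optimality

end LiquidityModel

open LiquidityModel in
theorem lemma3p1 {Ω : Type*} [mΩ : MeasurableSpace Ω] (P : Measure Ω) [IsProbabilityMeasure P]
    (ℱ : Filtration ℝ mΩ) (T γ lam a : ℝ) (hT : 0 < T) (hγ : 0 < γ) (hlam : 0 < lam)
    (m : ℕ) (S : ItoPriceProcess ℱ P T m) :
    -- the conditional expectations have a progressively measurable version
    (∃ ξ : ℝ → Ω → ℝ, IsSignal S γ lam ξ) ∧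
    ∀ ξ : ℝ → Ω → ℝ, IsSignal S γ lam ξ →
      -- the explicit portfolio, with the rate given by the random ODE, is optimal
      IsOptimal S γ lam a (position T γ lam a ξ)
        (rate T γ lam ξ (position T γ lam a ξ)) ∧
      -- optimal portfolios are `dt × P`-a.e. unique
      (∀ ψ ψ' : ℝ → Ω → ℝ, IsOptimal S γ lam a ψ ψ' →
        ∀ᵐ x ∂(timeProd P T), ψ x.1 x.2 = position T γ lam a ξ x.1 x.2) ∧
      -- the optimal trading rate is characterized by the random ODE
      (∀ ψ ψ' : ℝ → Ω → ℝ, IsPortfolio ℱ P T a ψ ψ' →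
        (IsOptimal S γ lam a ψ ψ' ↔
          ∀ᵐ x ∂(timeProd P T), ψ' x.1 x.2 = rate T γ lam ξ ψ x.1 x.2)) := by
  refine ⟨exists_isSignal S hT.le, fun ξ hξ => ?_⟩
  have hpos : IsPortfolio ℱ P T a (position T γ lam a ξ)
      (rate T γ lam ξ (position T γ lam a ξ)) :=
    isPortfolio_position hT.le (hξ.isProgLp hT.le)
  refine ⟨(hpos.isOptimal_iff hT.le hγ.le hlam hξ).2 (ae_of_all _ fun _ => rfl),
    fun ψ ψ' hψ => ?_, fun ψ ψ' hψ => hψ.isOptimal_iff hT.le hγ.le hlam hξ⟩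
  exact hψ.1.ae_eq_position hT.le ((hψ.1.isOptimal_iff hT.le hγ.le hlam hξ).1 hψ)
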